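/- **Theorem 3.1 (Asymptotic unbiasedness, as corrected by the authors).** Let $m\ge 1$ and $k\ge 1$ be integers and let $X_1,X_2,\dots$ be i.i.d. random vectors in $\mathbb{R}^m$ whose law has a density $f$ with respect to Lebesgue measure. For $N\ge k+1$ and $1\le i\le N$ let $\rho^{(i)}_{k,N-1}$ be the $k$-th smallest of the $N-1$ Euclidean distances $|X_i-X_j|$, $1\le j\le N$, $j\ne i$. For $q\neq 1$, $q<k+1$, put $$\hat I_{N,k,q}=\frac1N\sum_{i=1}^N \zeta_{N,i,k}^{\,1-q},\qquad \zeta_{N,i,k}=(N-1)\,C_k\,V_m\,\bigl(\rho^{(i)}_{k,N-1}\bigr)^m,$$ where $$V_m=\frac{\pi^{m/2}}{\Gamma(m/2+1)},\qquad C_k=\Bigl[\frac{\Gamma(k)}{\Gamma(k+1-q)}\Bigr]^{1/(1-q)},$$ and let $$I_q=\int_{\mathbb{R}^m} f^q(x)\,dx,\qquad r_c(f)=\sup\Bigl\{r>0:\int_{\mathbb{R}^m}|x|^r f(x)\,dx<\infty\Bigr\}\in[0,\infty]$$ (with $\sup\emptyset=0$). 1. If $0<q<1$, $I_q<\infty$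 and $r_c(f)>m\,\frac{1-q}{q}$, then $\hat I_{N,k,q}$ is integrable for every $N\ge k+1$ and $\mathbb{E}\,\hat I_{N,k,q}\to I_q$ as $N\to\infty$. 2. If $1<q<k+1$ and $f$ is (essentially) bounded, then $I_q<\infty$, $\hat I_{N,k,q}$ is integrable for every $N\ge k+1$, and $\mathbb{E}\,\hat I_{N,k,q}\to I_q$ as $N\to\infty$. -/

import Mathlib

open MeasureTheory ProbabilityTheory Filter
open scoped Topology ENNReal

noncomputable section

/-- The distance from `x i` to its `k`-th nearest neighbour among the other points of the sample
`x 0, …, x (N - 1)`: the `k`-th order statistic (counted from `k = 1`) of the `N - 1` distances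
`dist (x i) (x j)`, `j ≠ i`, repetitions included.
It is meaningful for `i < N` and `1 ≤ k ≤ N - 1`; the default value `0` is used if `k ≥ N`. -/
def kthNNDist {m : ℕ} (N k : ℕ) (x : ℕ → EuclideanSpace ℝ (Fin m)) (i : ℕ) : ℝ :=
  ((((Finset.range N).erase i).val.map fun j => dist (x i) (x j)).sort (· ≤ ·)).getD (k - 1) 0

/-- The volume `V_m` of the Euclidean unit ball of `ℝ^m`. -/
def unitBallVol (m : ℕ) : ℝ :=
  Real.pi ^ ((m : ℝ) / 2) / Real.Gamma ((m : ℝ) / 2 + 1)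

/-- The constant `C_k = [Γ(k) / Γ(k + 1 - q)]^{1 / (1 - q)}`. -/
def nnConst (k : ℕ) (q : ℝ) : ℝ :=
  (Real.Gamma k / Real.Gamma (k + 1 - q)) ^ (1 / (1 - q))

/-- `ζ_{N,i,k} = (N - 1) C_k V_m (ρ^{(i)}_{k,N-1})^m`. -/
def nnZeta {m : ℕ} (N k : ℕ) (q : ℝ) (x : ℕ → EuclideanSpace ℝ (Fin m)) (i : ℕ) : ℝ :=
  ((N : ℝ) - 1) * nnConst k q * unitBallVol m * kthNNDist N k x i ^ m

/-- The `k`-th nearest-neighbour estimator `Î_{N,k,q}` computed from `x 0, …, x (N - 1)`. -/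
def nnEstimator {m : ℕ} (N k : ℕ) (q : ℝ) (x : ℕ → EuclideanSpace ℝ (Fin m)) : ℝ :=
  (1 / (N : ℝ)) * ∑ i ∈ Finset.range N, nnZeta N k q x i ^ (1 - q)

/-- `I_q = ∫ f^q` with respect to Lebesgue measure on `ℝ^m`. -/
def renyiIntegral {m : ℕ} (f : EuclideanSpace ℝ (Fin m) → ℝ) (q : ℝ) : ℝ :=
  ∫ x, f x ^ q

/-- The critical moment `r_c(f) = sup {r > 0 : ∫ |x|^r f(x) dx < ∞}`, with values in `[0, ∞]`. -/
def criticalMoment {m : ℕ} (f : EuclideanSpace ℝ (Fin m) → ℝ) : ℝ≥0∞ :=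
  sSup (ENNReal.ofReal '' {r : ℝ | 0 < r ∧ ∫⁻ x, ENNReal.ofReal (‖x‖ ^ r * f x) < ∞})

end

/-! Put `a = 1 - q` and `n = N - 1`. The variables `ζ i` share one law, so the expected estimator is
the moment `E ζ ^ a` of a single one, and the layer-cake formula writes it as an integral of tail
probabilities of `ζ`.

Pointwise limit of the tails: given `X i = x`, the event `ζ > u` says that fewer than `k` of the `n`
other points fall in a ball around `x` of volume `u / (n C_k)`. By Lebesgue differentiation `n`
times the mass of that ball tends to `f x * u / C_k` for almost every `x`, so the binomial
probability tends to a Poisson one (`tendsto_nnZetaTail`). The limit is the tail of `C_k G / f x`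
with `G` of law Gamma(k, 1). Its moment of order `a` is `f x ^ (q - 1)`, by the choice of `C_k`, and
integrating this against `f` gives `I_q` (`lintegral_limit_eq`).

Exchange of limit and integral: it suffices that the tails of `ζ ^ a` are `O(t ^ (-γ))` with `γ >
1`, uniformly in `n` (`tendsto_lintegral_tail`). For `q < 1`, large distances are the danger. A
packing argument, valid for every sample, bounds `∑ (N ρ_i ^ m) ^ s` by a multiple of `∑ (1 + ‖x_i‖)
^ r` (`exists_sum_kthNNDist_rpow_le`); Markov's inequality with some `s > 1 - q` then gives the
decay (`exists_nnZetaTail_le`). For `q > 1`, small distances are the danger. A union bound over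
`k`-subsets and the boundedness of `f` give `P (ζ ≤ u) = O(u ^ k)` (`measure_nnZeta_le_le`), and `k
> q - 1`. -/

/-- In a sorted list, the entry of index `n` is at most `r` iff more than `n` entries are. -/
theorem List.Pairwise.getElem_le_iff_lt_countP {l : List ℝ} (h : l.Pairwise (· ≤ ·)) (r : ℝ)
    {n : ℕ} (hn : n < l.length) : l[n] ≤ r ↔ n < l.countP (· ≤ r) := by
  induction l generalizing n with
  | nil => simp at hn
  | cons a l ih =>
    rw [List.pairwise_cons] at h
    rw [List.countP_cons]
    by_cases ha : a ≤ r
    · cases n with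
      | zero => simp [ha]
      | succ n =>
        simp only [List.getElem_cons_succ, ha, decide_true, if_true, Nat.add_lt_add_iff_right]
        exact ih h.2 (by simpa using hn)
    · have h0 : l.countP (· ≤ r) = 0 := by
        rw [List.countP_eq_zero]
        intro b hb
        simpa using (not_le.1 ha).trans_le (h.1 b hb)
      simp only [h0, ha, decide_false]
      have hm := List.getElem_mem hn
      rw [List.mem_cons] at hm
      have : r < (a :: l)[n] := by
        rcases hm with hm | hm
        · rw [hm]; exact not_le.1 ha
        · exact (not_le.1 ha).trans_le (h.1 _ hm)
      simp [this]

/-! ### The order statistic, expressed by counting neighbours -/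

section OrderStatistic

variable {m : ℕ} {N k i : ℕ}

/-- Every later fact about the order statistic goes through this count. Since `k ≤ N - 1`, the index
`k - 1` lies inside the sorted list and the default value `0` never occurs. -/
theorem kthNNDist_le_iff (hk : 1 ≤ k) (hN : k + 1 ≤ N) (hi : i ∈ Finset.range N)
    (x : ℕ → EuclideanSpace ℝ (Fin m)) (r : ℝ) :
    kthNNDist N k x i ≤ r ↔
      k ≤ (((Finset.range N).erase i).filter fun j => dist (x i) (x j) ≤ r).card := by
  set s := ((Finset.range N).erase i).val.map fun j => dist (x i) (x j) with hs
  have hlen : (s.sort (· ≤ ·)).length = N - 1 := by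
    rw [Multiset.length_sort, hs, Multiset.card_map, Finset.card_val, Finset.card_erase_of_mem hi,
      Finset.card_range]
  have hlt : k - 1 < (s.sort (· ≤ ·)).length := by omega
  have hcount : (s.sort (· ≤ ·)).countP (· ≤ r) =
      (((Finset.range N).erase i).filter fun j => dist (x i) (x j) ≤ r).card := by
    rw [← Multiset.coe_countP, Multiset.sort_eq, hs, Multiset.countP_map]
    rfl
  unfold kthNNDist
  rw [← hs, List.getD_eq_getElem _ _ hlt,
    (Multiset.pairwise_sort s (· ≤ ·)).getElem_le_iff_lt_countP r hlt, hcount]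
  omega

theorem lt_kthNNDist_iff (hk : 1 ≤ k) (hN : k + 1 ≤ N) (hi : i ∈ Finset.range N)
    (x : ℕ → EuclideanSpace ℝ (Fin m)) (r : ℝ) :
    r < kthNNDist N k x i ↔
      (((Finset.range N).erase i).filter fun j => dist (x i) (x j) ≤ r).card < k := by
  rw [← not_le, kthNNDist_le_iff hk hN hi, not_le]

theorem kthNNDist_nonneg (hk : 1 ≤ k) (hN : k + 1 ≤ N) (hi : i ∈ Finset.range N)
    (x : ℕ → EuclideanSpace ℝ (Fin m)) : 0 ≤ kthNNDist N k x i := by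
  by_contra! h
  obtain ⟨r, hr, hr0⟩ := exists_between h
  have := (kthNNDist_le_iff hk hN hi x r).1 hr.le
  have h0 : (((Finset.range N).erase i).filter fun j => dist (x i) (x j) ≤ r) = ∅ :=
    Finset.filter_eq_empty_iff.2 fun j _ => not_le.2 (hr0.trans_le dist_nonneg)
  rw [h0, Finset.card_empty] at this
  omega

theorem exists_kthNNDist_le_dist (hk : 1 ≤ k) (hN : k + 1 ≤ N) (hi : i ∈ Finset.range N)
    (x : ℕ → EuclideanSpace ℝ (Fin m)) :
    ∃ j ∈ Finset.range N, kthNNDist N k x i ≤ dist (x i) (x j) := by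
  have h := (kthNNDist_le_iff hk hN hi x _).1 le_rfl
  by_contra! hcon
  set S := (Finset.range N).erase i
  have hS : S.Nonempty := by
    rw [← Finset.card_pos, Finset.card_erase_of_mem hi, Finset.card_range]; omega
  obtain ⟨j, hj, hmax⟩ := S.exists_max_image (fun j => dist (x i) (x j)) hS
  have h1 := hcon j (Finset.mem_of_mem_erase hj)
  rw [lt_kthNNDist_iff hk hN hi, Finset.filter_true_of_mem hmax, Finset.card_erase_of_mem hi,
    Finset.card_range] at h1
  omega

/-- The balls of half the `k`-th nearest-neighbour distance cover every point at most `k` times. -/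
theorem card_dist_lt_half_kthNNDist_le (hk : 1 ≤ k) (hN : k + 1 ≤ N)
    (x : ℕ → EuclideanSpace ℝ (Fin m)) (z : EuclideanSpace ℝ (Fin m)) :
    ((Finset.range N).filter fun i => dist z (x i) < kthNNDist N k x i / 2).card ≤ k := by
  by_contra! h
  set A := (Finset.range N).filter fun i => dist z (x i) < kthNNDist N k x i / 2 with hA
  -- Take the member `i` of `A` farthest from `z`. The other members, at least `k` of them, lie
  -- within `2 * dist z (x i)` of `x i`, so the `k`-th neighbour distance of `x i` is at most that,
  -- contrary to membership in `A`.
  have hne : A.Nonempty := Finset.card_pos.1 (by omega)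
  obtain ⟨i, hi, hmax⟩ := A.exists_max_image (fun i => dist z (x i)) hne
  have hi' := Finset.mem_filter.1 hi
  have hle : kthNNDist N k x i ≤ 2 * dist z (x i) := by
    rw [kthNNDist_le_iff hk hN hi'.1]
    have hsub : A.erase i ⊆
        ((Finset.range N).erase i).filter fun j => dist (x i) (x j) ≤ 2 * dist z (x i) := by
      intro j hj
      have hjA := Finset.mem_of_mem_erase hj
      refine Finset.mem_filter.2 ⟨Finset.mem_erase.2 ⟨(Finset.mem_erase.1 hj).1,
        (Finset.mem_filter.1 hjA).1⟩, ?_⟩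
      have h1 := hmax j hjA
      have h2 := dist_triangle_left (x i) (x j) z
      linarith
    have := Finset.card_le_card hsub
    rw [Finset.card_erase_of_mem hi] at this
    omega
  linarith [hi'.2]

theorem measurable_kthNNDist {Ω : Type*} [MeasurableSpace Ω] (hk : 1 ≤ k) (hN : k + 1 ≤ N)
    (hi : i ∈ Finset.range N) {X : ℕ → Ω → EuclideanSpace ℝ (Fin m)}
    (hX : ∀ i, Measurable (X i)) : Measurable fun ω => kthNNDist N k (fun i => X i ω) i := by
  refine measurable_of_Iic fun r => ?_
  have : ((fun ω => kthNNDist N k (fun i => X i ω) i) ⁻¹' Set.Iic r) =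
      {ω | (k : ℝ) ≤ ∑ j ∈ (Finset.range N).erase i,
        Set.indicator {ω | dist (X i ω) (X j ω) ≤ r} (fun _ => (1 : ℝ)) ω} := by
    ext ω
    simp only [Set.mem_preimage, Set.mem_Iic, kthNNDist_le_iff hk hN hi, Set.mem_ofPred_eq,
      Finset.card_filter, Set.indicator_apply]
    rw [← Nat.cast_le (α := ℝ)]
    push_cast
    rfl
  rw [this]
  refine measurableSet_le measurable_const (Finset.measurable_sum _ fun j _ => ?_)
  exact measurable_const.indicator (measurableSet_le ((hX i).dist (hX j)) measurable_const)

end OrderStatistic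

/-! ### Deterministic packing bound for sums of powers of the distances -/

section MomentBound

variable {m : ℕ} {N k : ℕ}

theorem volume_closedBall_eq_unitBallVol (hm : 1 ≤ m) (x : EuclideanSpace ℝ (Fin m)) {r : ℝ}
    (hr : 0 ≤ r) :
    volume (Metric.closedBall x r) = ENNReal.ofReal (unitBallVol m * r ^ m) := by
  have : Nonempty (Fin m) := ⟨⟨0, hm⟩⟩
  rw [EuclideanSpace.volume_closedBall, Fintype.card_fin, unitBallVol, mul_comm,
    ← ENNReal.ofReal_pow hr, ← ENNReal.ofReal_mul' (by positivity)]
  congr 3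
  rw [Real.sqrt_eq_rpow, ← Real.rpow_natCast, ← Real.rpow_mul Real.pi_pos.le]
  congr 1
  ring

theorem unitBallVol_pos (m : ℕ) : 0 < unitBallVol m := by
  unfold unitBallVol
  have := Real.Gamma_pos_of_pos (s := (m : ℝ) / 2 + 1) (by positivity)
  positivity

theorem volume_real_ball (hm : 1 ≤ m) (x : EuclideanSpace ℝ (Fin m)) {r : ℝ}
    (hr : 0 ≤ r) : volume.real (Metric.ball x r) = unitBallVol m * r ^ m := by
  have : Nonempty (Fin m) := ⟨⟨0, hm⟩⟩
  have : 0 ≤ unitBallVol m * r ^ m := mul_nonneg (unitBallVol_pos m).le (by positivity)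
  rw [measureReal_def, ← Measure.addHaar_closedBall_eq_addHaar_ball,
    volume_closedBall_eq_unitBallVol hm x hr, ENNReal.toReal_ofReal this]

/-- A packing bound: since the balls of radii `ρ i / 2` overlap at most `k` times, the sum of the
weighted volumes `ρ i ^ m (1 + ‖x i‖) ^ (-b)` with `ρ i ≤ 2 (1 + ‖x i‖)` is bounded. -/
theorem sum_kthNNDist_pow_mul_le (hm : 1 ≤ m) (hk : 1 ≤ k) (hN : k + 1 ≤ N) {b : ℝ}
    (hb : (m : ℝ) < b) (x : ℕ → EuclideanSpace ℝ (Fin m)) :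
    ∑ i ∈ (Finset.range N).filter (fun i => kthNNDist N k x i ≤ 2 * (1 + ‖x i‖)),
      kthNNDist N k x i ^ m * (1 + ‖x i‖) ^ (-b) ≤
    k * (∫ z : EuclideanSpace ℝ (Fin m), (1 + ‖z‖) ^ (-b)) * (2 ^ b * 2 ^ m / unitBallVol m) := by
  set G := (Finset.range N).filter (fun i => kthNNDist N k x i ≤ 2 * (1 + ‖x i‖)) with hG
  set w : EuclideanSpace ℝ (Fin m) → ℝ := fun z => (1 + ‖z‖) ^ (-b) with hw
  have hb0 : 0 ≤ b := (Nat.cast_nonneg m).trans hb.le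
  have hw0 : ∀ z, 0 ≤ w z := fun z => by positivity
  have hwint : Integrable w := integrable_one_add_norm (by simpa using hb)
  have hV := unitBallVol_pos m
  have hρ0 : ∀ i ∈ Finset.range N, 0 ≤ kthNNDist N k x i := fun i hi => kthNNDist_nonneg hk hN hi x
  set B : ℕ → Set (EuclideanSpace ℝ (Fin m)) := fun i => Metric.ball (x i) (kthNNDist N k x i / 2)
  have hterm : ∀ i ∈ G, kthNNDist N k x i ^ m * (1 + ‖x i‖) ^ (-b) ≤
      (∫ z, (B i).indicator w z) * (2 ^ b * 2 ^ m / unitBallVol m) := by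
    intro i hi
    obtain ⟨hiN, hi2⟩ := Finset.mem_filter.1 hi
    have hρ := hρ0 i hiN
    -- On the ball `B i` the restriction on the radius gives `1 + ‖z‖ ≤ 2 * (1 + ‖x i‖)`, so the
    -- weight there is at least its value at `x i` up to the factor `2 ^ (-b)`.
    have h1 : ∫ z in B i, (2 * (1 + ‖x i‖)) ^ (-b) ≤ ∫ z in B i, w z := by
      refine setIntegral_mono_on (integrableOn_const measure_ball_lt_top.ne) hwint.integrableOn
        measurableSet_ball fun z hz => ?_
      refine Real.rpow_le_rpow_of_nonpos (by positivity) ?_ (by linarith)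
      have h2 : ‖z - x i‖ < kthNNDist N k x i / 2 := by rwa [← dist_eq_norm]
      have h3 : ‖z‖ ≤ ‖z - x i‖ + ‖x i‖ := norm_le_norm_sub_add z (x i)
      linarith
    rw [setIntegral_const, volume_real_ball hm _ (by positivity), smul_eq_mul,
      Real.mul_rpow (by norm_num) (by positivity), Real.rpow_neg (by norm_num : (0 : ℝ) ≤ 2),
      div_pow] at h1
    rw [integral_indicator measurableSet_ball]
    calc kthNNDist N k x i ^ m * (1 + ‖x i‖) ^ (-b)
        = (unitBallVol m * (kthNNDist N k x i ^ m / 2 ^ m) * ((2 ^ b)⁻¹ * (1 + ‖x i‖) ^ (-b))) *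
          (2 ^ b * 2 ^ m / unitBallVol m) := by
          have : (2 : ℝ) ^ b ≠ 0 := by positivity
          field_simp
      _ ≤ _ := by gcongr
  refine (Finset.sum_le_sum hterm).trans ?_
  rw [← Finset.sum_mul]
  refine mul_le_mul_of_nonneg_right ?_ (by positivity)
  rw [← integral_finsetSum _ fun i _ => hwint.indicator measurableSet_ball,
    ← integral_const_mul]
  refine integral_mono (integrable_finsetSum _ fun i _ => hwint.indicator measurableSet_ball)
    (hwint.const_mul _) fun z => ?_
  -- Each `z` lies in at most `k` of the balls, so the sum of the indicators is at most `k * w z`.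
  have h1 : ∑ i ∈ G, (B i).indicator w z ≤
      ∑ i ∈ Finset.range N, if dist z (x i) < kthNNDist N k x i / 2 then w z else 0 := by
    refine (Finset.sum_le_sum_of_subset_of_nonneg (Finset.filter_subset _ _) fun i _ _ =>
      Set.indicator_nonneg (fun z _ => hw0 z) z).trans (le_of_eq ?_)
    exact Finset.sum_congr rfl fun i _ => by
      classical simp only [Set.indicator_apply, B, Metric.mem_ball]
  refine h1.trans ?_
  rw [← Finset.sum_filter, Finset.sum_const, nsmul_eq_mul]
  exact mul_le_mul_of_nonneg_right
    (by exact_mod_cast card_dist_lt_half_kthNNDist_le hk hN x z) (hw0 z)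

theorem rpow_mul_rpow_le_add {s : ℝ} (hs0 : 0 < s) (hs1 : s < 1) {a c : ℝ} (ha : 0 ≤ a)
    (hc : 0 ≤ c) : a ^ s * c ^ (1 - s) ≤ a + c := by
  have := Real.geom_mean_le_arith_mean2_weighted hs0.le (sub_nonneg.2 hs1.le) ha hc (by ring)
  nlinarith

/-- The sum of the powers `ρ i ^ (m s)` of the `k`-th nearest-neighbour distances in a sample of
`N` points is at most of order `N ^ (1 - s)` when the `r`-th moments of the points stay bounded. -/
theorem exists_sum_kthNNDist_rpow_le (hm : 1 ≤ m) (hk : 1 ≤ k) {s r : ℝ} (hs0 : 0 < s)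
    (hs1 : s < 1) (hr : m * s < r * (1 - s)) :
    ∃ K : ℝ, 0 ≤ K ∧ ∀ N, k + 1 ≤ N → ∀ x : ℕ → EuclideanSpace ℝ (Fin m),
      (N : ℝ) ^ s * ∑ i ∈ Finset.range N, (kthNNDist N k x i ^ m) ^ s ≤
        K * ∑ i ∈ Finset.range N, (1 + ‖x i‖) ^ r := by
  have h1s : 0 < 1 - s := by linarith
  -- With this `b` the weight `(1 + ‖x‖) ^ (-b)`, raised to the power `s`, cancels `((1 + ‖x‖) ^ r)
  -- ^ (1 - s)`, and the hypothesis on `r` says that `b > m`, which makes the weight integrable.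
  set b := r * (1 - s) / s with hb
  have hmb : (m : ℝ) < b := by rwa [hb, lt_div_iff₀ hs0]
  have hbs : b * s = r * (1 - s) := by rw [hb]; field_simp
  have hr0 : 0 < r := by
    by_contra! h
    nlinarith [mul_nonneg (Nat.cast_nonneg (α := ℝ) m) hs0.le]
  set K₁ := k * (∫ z : EuclideanSpace ℝ (Fin m), (1 + ‖z‖) ^ (-b)) *
    (2 ^ b * 2 ^ m / unitBallVol m) with hK₁
  have hV := unitBallVol_pos m
  have hK₁0 : 0 ≤ K₁ := by
    have : 0 ≤ ∫ z : EuclideanSpace ℝ (Fin m), (1 + ‖z‖) ^ (-b) :=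
      integral_nonneg fun z => by positivity
    positivity
  refine ⟨K₁ + 1 + 2 * k * (2 ^ m) ^ s, by positivity, fun N hN x => ?_⟩
  have hN0 : (0 : ℝ) ≤ N := Nat.cast_nonneg N
  have hρ0 : ∀ i ∈ Finset.range N, 0 ≤ kthNNDist N k x i := fun i hi => kthNNDist_nonneg hk hN hi x
  set M := ∑ i ∈ Finset.range N, (1 + ‖x i‖) ^ r with hM
  have hone : ∀ i, 1 ≤ (1 + ‖x i‖) ^ r := fun i =>
    Real.one_le_rpow (by linarith [norm_nonneg (x i)]) hr0.le
  have hNM : (N : ℝ) ≤ M := by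
    calc (N : ℝ) = ∑ i ∈ Finset.range N, (1 : ℝ) := by simp
      _ ≤ M := Finset.sum_le_sum fun i _ => hone i
  rw [← Finset.sum_filter_add_sum_filter_not (Finset.range N)
    (fun i => kthNNDist N k x i ≤ 2 * (1 + ‖x i‖)), mul_add, Finset.mul_sum, Finset.mul_sum]
  set G := (Finset.range N).filter (fun i => kthNNDist N k x i ≤ 2 * (1 + ‖x i‖)) with hG
  set G' := (Finset.range N).filter (fun i => ¬ kthNNDist N k x i ≤ 2 * (1 + ‖x i‖)) with hG'
  have hgood : ∑ i ∈ G, (N : ℝ) ^ s * (kthNNDist N k x i ^ m) ^ s ≤ (K₁ + 1) * M := by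
    calc ∑ i ∈ G, (N : ℝ) ^ s * (kthNNDist N k x i ^ m) ^ s
        ≤ ∑ i ∈ G, (N * (kthNNDist N k x i ^ m * (1 + ‖x i‖) ^ (-b)) + (1 + ‖x i‖) ^ r) := by
          refine Finset.sum_le_sum fun i hi => ?_
          have hρ := hρ0 i (Finset.mem_filter.1 hi).1
          refine le_trans (le_of_eq ?_) (rpow_mul_rpow_le_add hs0 hs1 (by positivity)
            (by positivity))
          rw [Real.mul_rpow hN0 (by positivity), Real.mul_rpow (by positivity) (by positivity),
            ← Real.rpow_mul (by positivity), ← Real.rpow_mul (by positivity), mul_assoc, mul_assoc,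
            ← Real.rpow_add (by positivity), neg_mul, hbs, neg_add_cancel, Real.rpow_zero, mul_one]
      _ ≤ N * K₁ + M := by
          rw [Finset.sum_add_distrib, ← Finset.mul_sum]
          refine add_le_add (mul_le_mul_of_nonneg_left
            (sum_kthNNDist_pow_mul_le hm hk hN hmb x) hN0) ?_
          exact Finset.sum_le_sum_of_subset_of_nonneg (Finset.filter_subset _ _)
            fun i _ _ => by positivity
      _ ≤ (K₁ + 1) * M := by nlinarith
  -- An index in `G'` has the origin in its ball of half radius, so the overlap bound at `0` leaves
  -- at most `k` such indices.
  have hcard : (G'.card : ℝ) ≤ k := by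
    refine Nat.cast_le.2 (le_trans (Finset.card_le_card fun i hi => ?_)
      (card_dist_lt_half_kthNNDist_le hk hN x 0))
    obtain ⟨h1, h2⟩ := Finset.mem_filter.1 hi
    refine Finset.mem_filter.2 ⟨h1, ?_⟩
    rw [dist_zero_left]
    linarith [not_le.1 h2]
  have hbad : ∑ i ∈ G', (N : ℝ) ^ s * (kthNNDist N k x i ^ m) ^ s ≤
      2 * k * (2 ^ m) ^ s * M := by
    have hi : ∀ i ∈ G', (N : ℝ) ^ s * (kthNNDist N k x i ^ m) ^ s ≤ 2 * (2 ^ m) ^ s * M := by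
      intro i hi
      have hiN := (Finset.mem_filter.1 hi).1
      have hρ := hρ0 i hiN
      -- The distance from `x i` to another point is at most twice the larger of the two norms; `l`
      -- is the index with the larger norm.
      obtain ⟨l, hl, hρl⟩ : ∃ l ∈ Finset.range N, kthNNDist N k x i ≤ 2 * (1 + ‖x l‖) := by
        obtain ⟨j, hj, hij⟩ := exists_kthNNDist_le_dist hk hN hiN x
        have := dist_le_norm_add_norm (x i) (x j)
        rcases le_total ‖x i‖ ‖x j‖ with h | h
        · exact ⟨j, hj, by linarith⟩
        · exact ⟨i, hiN, by linarith⟩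
      have hlM : (1 + ‖x l‖) ^ r ≤ M :=
        Finset.single_le_sum (f := fun i => (1 + ‖x i‖) ^ r) (fun i _ => by positivity) hl
      calc (N : ℝ) ^ s * (kthNNDist N k x i ^ m) ^ s
          ≤ (N : ℝ) ^ s * ((2 * (1 + ‖x l‖)) ^ m) ^ s := by gcongr
        _ = (2 ^ m) ^ s * ((N : ℝ) ^ s * (1 + ‖x l‖) ^ (m * s)) := by
            rw [mul_pow, Real.mul_rpow (by positivity) (by positivity), Real.rpow_mul (by positivity),
              Real.rpow_natCast]
            ring
        _ ≤ (2 ^ m) ^ s * ((N : ℝ) ^ s * ((1 + ‖x l‖) ^ r) ^ (1 - s)) := by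
            gcongr
            rw [← Real.rpow_mul (by positivity)]
            exact Real.rpow_le_rpow_of_exponent_le (by linarith [norm_nonneg (x l)]) hr.le
        _ ≤ (2 ^ m) ^ s * (N + (1 + ‖x l‖) ^ r) := by
            gcongr
            exact rpow_mul_rpow_le_add hs0 hs1 hN0 (by positivity)
        _ ≤ (2 ^ m) ^ s * (M + M) := by gcongr
        _ = 2 * (2 ^ m) ^ s * M := by ring
    refine (Finset.sum_le_card_nsmul _ _ _ hi).trans ?_
    rw [nsmul_eq_mul]
    have : 0 ≤ 2 * (2 ^ m : ℝ) ^ s * M := by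
      have := hN0.trans hNM
      positivity
    calc (G'.card : ℝ) * (2 * (2 ^ m) ^ s * M) ≤ k * (2 * (2 ^ m) ^ s * M) := by gcongr
      _ = _ := by ring
  calc _ ≤ (K₁ + 1) * M + 2 * k * (2 ^ m) ^ s * M := add_le_add hgood hbad
    _ = _ := by ring

end MomentBound

/-! ### Counting the independent points that fall in a set -/

/-- The probability that a binomial variable with parameters `n`, `p` is less than `k`. -/
def binomialTail (n k : ℕ) (p : ℝ) : ℝ :=
  ∑ l ∈ Finset.range k, n.choose l * p ^ l * (1 - p) ^ (n - l)

section Counting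

variable {Ω E : Type*} [MeasurableSpace Ω] {P : Measure Ω} [IsProbabilityMeasure P]
  [MeasurableSpace E] {X : ℕ → Ω → E} {μ : Measure E} {k : ℕ}

open Classical in
-- Prescribing exactly which points fall in `B` is an intersection of independent events, one for
-- each index.
theorem measureReal_filter_mem_eq (hX : ∀ i, Measurable (X i)) (hindep : iIndepFun X P)
    (hlaw : ∀ i, P.map (X i) = μ) {B : Set E} (hB : MeasurableSet B) {S A : Finset ℕ}
    (hA : A ⊆ S) :
    P.real {ω | S.filter (fun j => X j ω ∈ B) = A} =
      μ.real B ^ A.card * (1 - μ.real B) ^ (S.card - A.card) := by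
  have hμ : IsProbabilityMeasure μ := by
    rw [← hlaw 0]; exact Measure.isProbabilityMeasure_map (hX 0).aemeasurable
  have hset : {ω | S.filter (fun j => X j ω ∈ B) = A} =
      ⋂ j ∈ S, X j ⁻¹' (if j ∈ A then B else Bᶜ) := by
    ext ω
    simp only [Set.mem_ofPred_eq, Set.mem_iInter, Set.mem_preimage, Finset.ext_iff,
      Finset.mem_filter]
    refine forall_congr' fun j => ?_
    by_cases hj : j ∈ A
    · simp [hj, hA hj]
    · simp [hj]
  have hmeas : ∀ j, MeasurableSet (if j ∈ A then B else Bᶜ) := fun j => by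
    split_ifs
    exacts [hB, hB.compl]
  rw [measureReal_def, hset, hindep.measure_inter_preimage_eq_mul S fun j _ => hmeas j,
    ENNReal.toReal_prod]
  have : ∀ j ∈ S, (P (X j ⁻¹' (if j ∈ A then B else Bᶜ))).toReal =
      if j ∈ A then μ.real B else 1 - μ.real B := by
    intro j _
    rw [← Measure.map_apply (hX j) (hmeas j), hlaw, ← measureReal_def]
    split_ifs
    exacts [rfl, probReal_compl_eq_one_sub hB]
  rw [Finset.prod_congr rfl this, Finset.prod_ite, Finset.prod_const, Finset.prod_const,
    Finset.filter_mem_eq_inter, Finset.inter_eq_right.2 hA]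
  congr 2
  rw [← Finset.card_sdiff_of_subset hA, Finset.sdiff_eq_filter]

open Classical in
theorem measure_card_filter_mem_lt (hX : ∀ i, Measurable (X i)) (hindep : iIndepFun X P)
    (hlaw : ∀ i, P.map (X i) = μ) {B : Set E} (hB : MeasurableSet B) (S : Finset ℕ) :
    P {ω | (S.filter fun j => X j ω ∈ B).card < k} =
      ENNReal.ofReal (binomialTail S.card k (μ.real B)) := by
  set p := μ.real B with hp
  have hset : {ω | (S.filter fun j => X j ω ∈ B).card < k} =
      ⋃ A ∈ S.powerset.filter (fun A => A.card < k), {ω | S.filter (fun j => X j ω ∈ B) = A} := by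
    ext ω
    simp
  have hmeas : ∀ A : Finset ℕ, MeasurableSet {ω | S.filter (fun j => X j ω ∈ B) = A} := by
    intro A
    have : {ω | S.filter (fun j => X j ω ∈ B) = A} =
        ⋂ j, {ω | (j ∈ S ∧ X j ω ∈ B) ↔ j ∈ A} := by
      ext ω
      simp [Finset.ext_iff]
    rw [this]
    refine MeasurableSet.iInter fun j => ?_
    have hj : MeasurableSet {ω | X j ω ∈ B} := hX j hB
    exact (((MeasurableSet.const _).inter hj).iff (MeasurableSet.const _))
  rw [← ofReal_measureReal, hset, measureReal_biUnion_finset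
    (fun A _ A' _ h => Set.disjoint_left.2 fun ω h1 h2 => h (h1.symm.trans h2))
    (fun A _ => hmeas A)]
  congr 1
  rw [Finset.sum_congr rfl fun A hA => measureReal_filter_mem_eq hX hindep hlaw hB
    (Finset.mem_powerset.1 (Finset.mem_filter.1 hA).1), Finset.sum_filter,
    Finset.sum_powerset_apply_card
      (fun l => if l < k then p ^ l * (1 - p) ^ (S.card - l) else 0), binomialTail]
  simp only [nsmul_eq_mul, mul_ite, mul_zero]
  rw [← Finset.sum_filter]
  -- `binomialTail` also sums over `l > S.card`, where the binomial coefficient is zero.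
  refine (Finset.sum_subset (fun l hl => Finset.mem_range.2 (Finset.mem_filter.1 hl).2)
    fun l hl hl' => ?_).trans (Finset.sum_congr rfl fun l _ => by ring)
  have : S.card < l := by
    by_contra! h
    exact hl' (Finset.mem_filter.2 ⟨Finset.mem_range.2 (by omega), Finset.mem_range.1 hl⟩)
  simp [Nat.choose_eq_zero_of_lt this]

open Classical in
omit [IsProbabilityMeasure P] in
-- Union bound over the `k`-element subsets of `S` whose points all fall in `B`.
theorem measure_le_card_filter_mem_le (hX : ∀ i, Measurable (X i)) (hindep : iIndepFun X P)
    (hlaw : ∀ i, P.map (X i) = μ) {B : Set E} (hB : MeasurableSet B) (S : Finset ℕ) :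
    P {ω | k ≤ (S.filter fun j => X j ω ∈ B).card} ≤ (S.card * μ B) ^ k := by
  have hsub : {ω | k ≤ (S.filter fun j => X j ω ∈ B).card} ⊆
      ⋃ A ∈ S.powersetCard k, ⋂ j ∈ A, X j ⁻¹' B := by
    intro ω hω
    obtain ⟨A, hA, hcard⟩ := Finset.exists_subset_card_eq (Set.mem_ofPred_eq ▸ hω)
    simp only [Set.mem_iUnion, Set.mem_iInter]
    exact ⟨A, Finset.mem_powersetCard.2 ⟨hA.trans (Finset.filter_subset _ _), hcard⟩,
      fun j hj => (Finset.mem_filter.1 (hA hj)).2⟩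
  calc P {ω | k ≤ (S.filter fun j => X j ω ∈ B).card}
      ≤ ∑ A ∈ S.powersetCard k, P (⋂ j ∈ A, X j ⁻¹' B) :=
        (measure_mono hsub).trans (measure_biUnion_finset_le _ _)
    _ = ∑ A ∈ S.powersetCard k, μ B ^ k := by
        refine Finset.sum_congr rfl fun A hA => ?_
        rw [hindep.measure_inter_preimage_eq_mul A fun _ _ => hB,
          ← (Finset.mem_powersetCard.1 hA).2, ← Finset.prod_const]
        refine Finset.prod_congr rfl fun j _ => ?_
        rw [← Measure.map_apply (hX j) hB, hlaw]
    _ = S.card.choose k * μ B ^ k := by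
        rw [Finset.sum_const, Finset.card_powersetCard, nsmul_eq_mul]
    _ ≤ (S.card * μ B) ^ k := by
        rw [mul_pow]
        gcongr
        exact_mod_cast Nat.choose_le_pow _ _

end Counting

/-! ### Law of the nearest-neighbour distance -/

section Distribution

variable {Ω : Type*} [MeasurableSpace Ω] {P : Measure Ω} [IsProbabilityMeasure P] {m N k i : ℕ}
  {X : ℕ → Ω → EuclideanSpace ℝ (Fin m)} {μ : Measure (EuclideanSpace ℝ (Fin m))}

theorem measurable_measure_closedBall [IsProbabilityMeasure μ] (r : ℝ) :
    Measurable fun x => μ (Metric.closedBall x r) := by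
  have hD : MeasurableSet {p : EuclideanSpace ℝ (Fin m) × EuclideanSpace ℝ (Fin m) |
      dist p.2 p.1 ≤ r} := measurableSet_le (by fun_prop) measurable_const
  exact measurable_measure_prodMk_left hD

/-- Conditioning the number of neighbours of `X i` on the value of `X i`. -/
theorem measure_card_filter_dist_eq_lintegral (hX : ∀ i, Measurable (X i))
    (hindep : iIndepFun X P) (hlaw : ∀ i, P.map (X i) = μ) {S : Finset ℕ} (hi : i ∉ S) (r : ℝ)
    (T : Set ℕ) :
    P {ω | (S.filter fun j => dist (X i ω) (X j ω) ≤ r).card ∈ T} =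
      ∫⁻ x, P {ω | (S.filter fun j => dist x (X j ω) ≤ r).card ∈ T} ∂μ := by
  set Y : Ω → S → EuclideanSpace ℝ (Fin m) := fun ω j => X j ω with hY
  have hYm : Measurable Y := measurable_pi_lambda _ fun j => hX j
  have hXY : IndepFun (X i) Y P := by
    have h1 := hindep.indepFun_finset {i} S (Finset.disjoint_singleton_left.2 hi) hX
    have h2 : Measurable fun y : ({i} : Finset ℕ) → EuclideanSpace ℝ (Fin m) =>
      y ⟨i, Finset.mem_singleton_self i⟩ := measurable_pi_apply _
    exact h1.comp h2 measurable_id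
  -- The count is a measurable function of the pair formed by `X i` and the points indexed by `S`.
  -- By independence the law of this pair is a product measure, and slicing it gives the conditional
  -- formula.
  set c : EuclideanSpace ℝ (Fin m) × (S → EuclideanSpace ℝ (Fin m)) → ℕ :=
    fun p => ∑ j, (if dist p.1 (p.2 j) ≤ r then 1 else 0) with hc
  have hDm : MeasurableSet (c ⁻¹' T) := by
    refine (Finset.measurable_sum _ fun j _ => ?_) (MeasurableSet.of_discrete (s := T))
    exact Measurable.ite (measurableSet_le (by fun_prop) measurable_const) measurable_const
      measurable_const
  have hcard : ∀ x ω, (x, Y ω) ∈ c ⁻¹' T ↔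
      (S.filter fun j => dist x (X j ω) ≤ r).card ∈ T := by
    intro x ω
    rw [Finset.card_filter, ← Finset.sum_coe_sort S]
    rfl
  calc P {ω | (S.filter fun j => dist (X i ω) (X j ω) ≤ r).card ∈ T}
      = P.map (fun ω => (X i ω, Y ω)) (c ⁻¹' T) := by
        rw [Measure.map_apply ((hX i).prodMk hYm) hDm]
        congr 1
        ext ω
        exact (hcard _ ω).symm
    _ = ∫⁻ x, P.map Y (Prod.mk x ⁻¹' (c ⁻¹' T)) ∂μ := by
        rw [(indepFun_iff_map_prod_eq_prod_map_map (hX i).aemeasurable hYm.aemeasurable).1 hXY,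
          hlaw, Measure.prod_apply hDm]
    _ = _ := by
        refine lintegral_congr fun x => ?_
        rw [Measure.map_apply hYm (measurable_prodMk_left hDm)]
        congr 1
        ext ω
        exact hcard x ω

theorem measure_lt_kthNNDist (hk : 1 ≤ k) (hN : k + 1 ≤ N) (hi : i ∈ Finset.range N)
    (hX : ∀ i, Measurable (X i)) (hindep : iIndepFun X P) (hlaw : ∀ i, P.map (X i) = μ) (r : ℝ) :
    P {ω | r < kthNNDist N k (fun i => X i ω) i} =
      ∫⁻ x, ENNReal.ofReal (binomialTail (N - 1) k (μ.real (Metric.closedBall x r))) ∂μ := by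
  simp only [lt_kthNNDist_iff hk hN hi]
  refine (measure_card_filter_dist_eq_lintegral hX hindep hlaw (Finset.notMem_erase i _) r
    (Set.Iio k)).trans (lintegral_congr fun x => ?_)
  have h := measure_card_filter_mem_lt (k := k) hX hindep hlaw
    (Metric.isClosed_closedBall (x := x) (ε := r)).measurableSet ((Finset.range N).erase i)
  rw [Finset.card_erase_of_mem hi, Finset.card_range] at h
  rw [← h]
  simp only [Metric.mem_closedBall', Set.mem_Iio]

theorem measure_kthNNDist_le_le (hk : 1 ≤ k) (hN : k + 1 ≤ N) (hi : i ∈ Finset.range N)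
    (hX : ∀ i, Measurable (X i)) (hindep : iIndepFun X P) (hlaw : ∀ i, P.map (X i) = μ) {r : ℝ}
    {c : ℝ≥0∞} (hc : ∀ x, ((N - 1 : ℕ) : ℝ≥0∞) * μ (Metric.closedBall x r) ≤ c) :
    P {ω | kthNNDist N k (fun i => X i ω) i ≤ r} ≤ c ^ k := by
  have hμ : IsProbabilityMeasure μ := by
    rw [← hlaw 0]; exact Measure.isProbabilityMeasure_map (hX 0).aemeasurable
  simp only [kthNNDist_le_iff hk hN hi]
  refine (measure_card_filter_dist_eq_lintegral hX hindep hlaw (Finset.notMem_erase i _) r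
    (Set.Ici k)).trans_le ((lintegral_mono fun x => ?_).trans_eq
      (by rw [lintegral_const, measure_univ, mul_one]))
  have h := measure_le_card_filter_mem_le (k := k) hX hindep hlaw
    (Metric.isClosed_closedBall (x := x) (ε := r)).measurableSet ((Finset.range N).erase i)
  rw [Finset.card_erase_of_mem hi, Finset.card_range] at h
  refine le_trans (le_of_eq ?_) (h.trans (pow_le_pow_left' (hc x) k))
  simp only [Metric.mem_closedBall', Set.mem_Ici]

end Distribution

/-! ### Poisson tails and moments of the Gamma distribution -/

/-- The probability that a Poisson variable of mean `y` is less than `k`. -/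
noncomputable def poissonTail (k : ℕ) (y : ℝ) : ℝ :=
  ∑ l ∈ Finset.range k, Real.exp (-y) * y ^ l / l.factorial

theorem continuous_poissonTail (k : ℕ) : Continuous (poissonTail k) := by
  unfold poissonTail
  fun_prop

theorem tendsto_binomialTail (k : ℕ) {p : ℕ → ℝ} {y : ℝ}
    (h : Tendsto (fun n : ℕ => n * p n) atTop (𝓝 y)) :
    Tendsto (fun n => binomialTail n k (p n)) atTop (𝓝 (poissonTail k y)) :=
  tendsto_finsetSum _ fun l _ => tendsto_choose_mul_pow_of_tendsto_mul_atTop l h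

/-- The derivative of the sum telescopes and leaves minus the Gamma(k, 1) density. This is what
identifies the Poisson tail with the Gamma tail. -/
theorem hasDerivAt_poissonTail {k : ℕ} (hk : 1 ≤ k) (y : ℝ) :
    HasDerivAt (poissonTail k) (-(y ^ (k - 1) * Real.exp (-y) / (k - 1).factorial)) y := by
  induction k, hk using Nat.le_induction with
  | base =>
    have h := (hasDerivAt_neg y).exp
    have : poissonTail 1 = fun y => Real.exp (-y) := by
      ext y; simp [poissonTail]
    rw [this]
    simpa using h
  | succ k hk ih =>
    have h1 : HasDerivAt (fun y : ℝ => Real.exp (-y) * y ^ k / k.factorial)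
        ((Real.exp (-y) * (-1) * y ^ k + Real.exp (-y) * (k * y ^ (k - 1))) / k.factorial) y :=
      (((hasDerivAt_neg y).exp).mul (hasDerivAt_pow k y)).div_const _
    have h2 : poissonTail (k + 1) =
        fun y => poissonTail k y + Real.exp (-y) * y ^ k / k.factorial := by
      ext y; rw [poissonTail, Finset.sum_range_succ]; rfl
    rw [h2]
    refine (ih.add h1).congr_deriv ?_
    obtain ⟨n, rfl⟩ : ∃ n, k = n + 1 := ⟨k - 1, by omega⟩
    simp only [Nat.add_sub_cancel, Nat.factorial_succ, Nat.cast_mul]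
    have : (n.factorial : ℝ) ≠ 0 := by positivity
    field_simp
    push_cast
    ring

theorem poissonTail_zero {k : ℕ} (hk : 1 ≤ k) : poissonTail k 0 = 1 := by
  obtain ⟨n, rfl⟩ : ∃ n, k = n + 1 := ⟨k - 1, by omega⟩
  rw [poissonTail, Finset.sum_range_succ']
  simp

theorem poissonTail_nonneg (k : ℕ) {y : ℝ} (hy : 0 ≤ y) : 0 ≤ poissonTail k y :=
  Finset.sum_nonneg fun l _ => by positivity

theorem poissonTail_le_one (k : ℕ) {y : ℝ} (hy : 0 ≤ y) : poissonTail k y ≤ 1 := by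
  have h := Real.sum_le_exp_of_nonneg hy k
  calc poissonTail k y = Real.exp (-y) * ∑ l ∈ Finset.range k, y ^ l / l.factorial := by
        rw [poissonTail, Finset.mul_sum]
        exact Finset.sum_congr rfl fun l _ => mul_div_assoc _ _ _
    _ ≤ Real.exp (-y) * Real.exp y := by gcongr
    _ = 1 := by rw [← Real.exp_add, neg_add_cancel, Real.exp_zero]

theorem gammaMeasure_Iio_zero {a r : ℝ} : gammaMeasure a r (Set.Iio 0) = 0 := by
  rw [gammaMeasure, withDensity_apply _ measurableSet_Iio, lintegral_gammaPDF_of_nonpos le_rfl]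

theorem gammaMeasure_Iic {k : ℕ} (hk : 1 ≤ k) {y : ℝ} (hy : 0 ≤ y) :
    gammaMeasure k 1 (Set.Iic y) = ENNReal.ofReal (1 - poissonTail k y) := by
  have hu : Set.Iic y = Set.Iio 0 ∪ Set.Icc 0 y := (Set.Iio_union_Icc_eq_Iic hy).symm
  have hdisj : Disjoint (Set.Iio (0 : ℝ)) (Set.Icc 0 y) :=
    Set.disjoint_left.2 fun a h1 h2 => not_le.2 (Set.mem_Iio.1 h1) h2.1
  rw [hu, measure_union hdisj measurableSet_Icc, gammaMeasure_Iio_zero, zero_add, gammaMeasure,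
    withDensity_apply _ measurableSet_Icc]
  have hpdf : ∀ u ∈ Set.Icc 0 y, gammaPDF k 1 u =
      ENNReal.ofReal (u ^ (k - 1) * Real.exp (-u) / (k - 1).factorial) := by
    intro u hu
    rw [gammaPDF_of_nonneg hu.1]
    obtain ⟨n, rfl⟩ : ∃ n, k = n + 1 := ⟨k - 1, by omega⟩
    push_cast
    rw [Real.Gamma_nat_eq_factorial, add_sub_cancel_right, Real.rpow_natCast, Real.one_rpow,
      one_mul]
    congr 1
    ring_nf
  have hcont : Continuous fun u : ℝ => u ^ (k - 1) * Real.exp (-u) / (k - 1).factorial := by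
    fun_prop
  rw [setLIntegral_congr_fun measurableSet_Icc hpdf, ← ofReal_integral_eq_lintegral_ofReal
    (hcont.integrableOn_Icc) ((ae_restrict_iff' measurableSet_Icc).2 (ae_of_all _ fun u hu => by
      have := hu.1
      positivity)), integral_Icc_eq_integral_Ioc,
    ← intervalIntegral.integral_of_le hy]
  congr 1
  have := intervalIntegral.integral_eq_sub_of_hasDerivAt (a := 0) (b := y)
    (fun u _ => (hasDerivAt_poissonTail hk u).neg) (by
      simpa using (hcont.intervalIntegrable 0 y))
  simp only [neg_neg, Pi.neg_apply] at this
  rw [this, poissonTail_zero hk]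
  ring

theorem gammaMeasure_Ioi {k : ℕ} (hk : 1 ≤ k) {y : ℝ} (hy : 0 ≤ y) :
    gammaMeasure k 1 (Set.Ioi y) = ENNReal.ofReal (poissonTail k y) := by
  have hk0 : (0 : ℝ) < k := by exact_mod_cast hk
  have := isProbabilityMeasure_gammaMeasure hk0 one_pos
  have hle := poissonTail_le_one k hy
  rw [← Set.compl_Iic, prob_compl_eq_one_sub measurableSet_Iic, gammaMeasure_Iic hk hy,
    ← ENNReal.ofReal_one, ← ENNReal.ofReal_sub _ (by linarith)]
  congr 1
  ring

theorem lintegral_rpow_gammaMeasure {k : ℕ} (hk : 1 ≤ k) {a : ℝ} (ha : 0 < k + a) :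
    ∫⁻ g, ENNReal.ofReal (g ^ a) ∂(gammaMeasure k 1) =
      ENNReal.ofReal (Real.Gamma (k + a) / Real.Gamma k) := by
  have hk0 : (0 : ℝ) < k := by exact_mod_cast hk
  have hΓ := Real.Gamma_pos_of_pos hk0
  have hm : Measurable fun g : ℝ => ENNReal.ofReal (g ^ a) := by fun_prop
  have hpdfm : Measurable (gammaPDF k 1) := (measurable_gammaPDFReal _ _).ennreal_ofReal
  rw [gammaMeasure, lintegral_withDensity_eq_lintegral_mul _ hpdfm hm,
    ← lintegral_add_compl _ measurableSet_Ioi (A := Set.Ioi (0 : ℝ)), Set.compl_Ioi,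
    ← setLIntegral_congr Iio_ae_eq_Iic]
  have h1 : ∫⁻ g in Set.Iio 0, (gammaPDF k 1 * fun g : ℝ => ENNReal.ofReal (g ^ a)) g = 0 := by
    rw [setLIntegral_congr_fun (g := fun _ => 0) measurableSet_Iio, lintegral_zero]
    intro g hg
    simp [gammaPDF_of_neg (Set.mem_Iio.1 hg)]
  have h2 : ∀ g ∈ Set.Ioi (0 : ℝ), (gammaPDF k 1 * fun g : ℝ => ENNReal.ofReal (g ^ a)) g =
      ENNReal.ofReal (Real.exp (-g) * g ^ (k + a - 1) / Real.Gamma k) := by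
    intro g hg
    have hg0 : 0 < g := hg
    rw [Pi.mul_apply, gammaPDF_of_nonneg hg0.le, ← ENNReal.ofReal_mul (by positivity)]
    congr 1
    rw [show (k : ℝ) + a - 1 = (k - 1) + a by ring, Real.rpow_add hg0]
    simp
    ring
  rw [h1, add_zero, setLIntegral_congr_fun measurableSet_Ioi h2,
    ← ofReal_integral_eq_lintegral_ofReal ((Real.GammaIntegral_convergent ha).div_const _)
      ((ae_restrict_iff' measurableSet_Ioi).2 (ae_of_all _ fun u hu => by
      have : (0 : ℝ) < u := hu
      positivity)), integral_div, ← Real.Gamma_eq_integral ha]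

theorem ae_gammaMeasure_pos {k : ℕ} (hk : 1 ≤ k) :
    ∀ᵐ g ∂(gammaMeasure k 1), 0 < g := by
  rw [ae_iff]
  have := gammaMeasure_Iic hk le_rfl
  simpa [poissonTail_zero hk, Set.Iic] using this

theorem lintegral_div_rpow_gammaMeasure {k : ℕ} (hk : 1 ≤ k) {a c : ℝ} (ha : 0 < k + a)
    (hc : 0 < c) :
    ∫⁻ g, ENNReal.ofReal ((g / c) ^ a) ∂(gammaMeasure k 1) =
      ENNReal.ofReal (c ^ (-a) * (Real.Gamma (k + a) / Real.Gamma k)) := by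
  rw [ENNReal.ofReal_mul (by positivity), ← lintegral_rpow_gammaMeasure hk ha,
    ← lintegral_const_mul _ (by fun_prop)]
  refine lintegral_congr_ae ?_
  filter_upwards [ae_gammaMeasure_pos hk] with g hg
  rw [← ENNReal.ofReal_mul (by positivity), Real.div_rpow hg.le hc.le, Real.rpow_neg hc.le]
  congr 1
  field_simp

/-- If `g` has law Gamma(k, 1), the integrand is the probability that `(g / c) ^ a > t`, so this is
the layer-cake formula for that moment. -/
theorem lintegral_poissonTail {k : ℕ} (hk : 1 ≤ k) {a c : ℝ} (ha : 0 < a) (hc : 0 < c) :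
    ∫⁻ t in Set.Ioi 0, ENNReal.ofReal (poissonTail k (c * t ^ (1 / a))) =
      ENNReal.ofReal (c ^ (-a) * (Real.Gamma (k + a) / Real.Gamma k)) := by
  have hpos := ae_gammaMeasure_pos hk
  rw [← lintegral_div_rpow_gammaMeasure hk (by positivity) hc, lintegral_eq_lintegral_meas_lt (gammaMeasure k 1)]
  · refine setLIntegral_congr_fun measurableSet_Ioi fun t ht => ?_
    have ht0 : 0 < t := ht
    rw [← gammaMeasure_Ioi hk (by positivity)]
    refine measure_congr ?_
    filter_upwards [hpos] with g hg
    refine propext ?_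
    change c * t ^ (1 / a) < g ↔ t < (g / c) ^ a
    rw [one_div, ← Real.rpow_inv_lt_iff_of_pos ht0.le (by positivity) ha, lt_div_iff₀ hc, mul_comm]
  · filter_upwards [hpos] with g hg
    simp only [Pi.zero_apply]
    positivity
  · fun_prop

/-- For `a < 0` the map `g ↦ (g / c) ^ a` reverses inequalities, so the distribution function of `g`
takes the place of its tail. -/
theorem lintegral_one_sub_poissonTail {k : ℕ} (hk : 1 ≤ k) {a c : ℝ} (ha : a < 0)
    (hka : 0 < k + a) (hc : 0 < c) :
    ∫⁻ t in Set.Ioi 0, ENNReal.ofReal (1 - poissonTail k (c * t ^ (1 / a))) =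
      ENNReal.ofReal (c ^ (-a) * (Real.Gamma (k + a) / Real.Gamma k)) := by
  have hpos := ae_gammaMeasure_pos hk
  rw [← lintegral_div_rpow_gammaMeasure hk hka hc, lintegral_eq_lintegral_meas_le (gammaMeasure k 1)]
  · refine setLIntegral_congr_fun measurableSet_Ioi fun t ht => ?_
    have ht0 : 0 < t := ht
    rw [← gammaMeasure_Iic hk (by positivity)]
    refine measure_congr ?_
    filter_upwards [hpos] with g hg
    refine propext ?_
    change g ≤ c * t ^ (1 / a) ↔ t ≤ (g / c) ^ a
    rw [one_div, ← Real.le_rpow_inv_iff_of_neg (by positivity) ht0 ha, div_le_iff₀ hc, mul_comm]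
  · filter_upwards [hpos] with g hg
    simp only [Pi.zero_apply]
    positivity
  · fun_prop

/-! ### Passing to the limit under the layer-cake integral -/

/-- Dominated convergence for the layer-cake integrals of tail functions that decay uniformly
faster than `1 / t`. -/
theorem tendsto_lintegral_tail {T : ℕ → ℝ → ℝ≥0∞} {T' : ℝ → ℝ≥0∞} {n₀ : ℕ} {K γ : ℝ}
    (hγ : 1 < γ) (hT : ∀ n, n₀ ≤ n → Antitone (T n)) (hT1 : ∀ n, n₀ ≤ n → ∀ t, 0 < t → T n t ≤ 1)
    (hTK : ∀ n, n₀ ≤ n → ∀ t, 0 < t → T n t ≤ ENNReal.ofReal (K * t ^ (-γ)))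
    (hlim : ∀ t, 0 < t → Tendsto (fun n => T n t) atTop (𝓝 (T' t))) :
    (∀ n, n₀ ≤ n → ∫⁻ t in Set.Ioi 0, T n t ≠ ∞) ∧ ∫⁻ t in Set.Ioi 0, T' t ≠ ∞ ∧
      Tendsto (fun n => ∫⁻ t in Set.Ioi 0, T n t) atTop (𝓝 (∫⁻ t in Set.Ioi 0, T' t)) := by
  -- The constant `1` makes the dominating function integrable near `0`, the power near infinity.
  set g : ℝ → ℝ≥0∞ := fun t => min 1 (ENNReal.ofReal (K * t ^ (-γ))) with hg
  have hgint : ∫⁻ t in Set.Ioi 0, g t ≠ ∞ := by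
    rw [← Set.Ioc_union_Ioi_eq_Ioi zero_le_one]
    refine ne_top_of_le_ne_top ?_ (lintegral_union_le _ _ _)
    refine ENNReal.add_ne_top.2 ⟨ne_top_of_le_ne_top ?_ (lintegral_mono fun t => min_le_left _ _),
      ne_top_of_le_ne_top ?_ (lintegral_mono fun t => min_le_right _ _)⟩
    · simp
    · have hint := (integrableOn_Ioi_rpow_of_lt (neg_lt_neg hγ) one_pos).const_mul K
      exact (Integrable.lintegral_lt_top hint).ne
  have hgT : ∀ n, n₀ ≤ n → ∀ t, 0 < t → T n t ≤ g t := fun n hn t ht =>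
    le_min (hT1 n hn t ht) (hTK n hn t ht)
  have hae : ∀ n, n₀ ≤ n → T n ≤ᵐ[volume.restrict (Set.Ioi 0)] g := fun n hn =>
    (ae_restrict_iff' measurableSet_Ioi).2 (ae_of_all _ fun t ht => hgT n hn t ht)
  refine ⟨fun n hn => ne_top_of_le_ne_top hgint (lintegral_mono_ae (hae n hn)),
    ne_top_of_le_ne_top hgint (setLIntegral_mono' measurableSet_Ioi fun t ht => ?_), ?_⟩
  · exact le_of_tendsto (hlim t ht) ((eventually_ge_atTop n₀).mono fun n hn => hgT n hn t ht)
  · refine tendsto_lintegral_filter_of_dominated_convergence g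
      ((eventually_ge_atTop n₀).mono fun n hn => (hT n hn).measurable)
      ((eventually_ge_atTop n₀).mono hae) hgint
      ((ae_restrict_iff' measurableSet_Ioi).2 (ae_of_all _ hlim))

/-! ### The variable `ζ` and the pointwise limit of its tails -/

section Estimator

variable {m k : ℕ} {q : ℝ}

theorem nnConst_pos (hk : 1 ≤ k) (hq : q < k + 1) : 0 < nnConst k q := by
  have h1 := Real.Gamma_pos_of_pos (s := (k : ℝ)) (by exact_mod_cast hk)
  have h2 := Real.Gamma_pos_of_pos (s := (k : ℝ) + 1 - q) (by linarith)
  unfold nnConst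
  positivity

theorem nnConst_rpow (hk : 1 ≤ k) (hq : q < k + 1) (hq1 : q ≠ 1) :
    nnConst k q ^ (1 - q) = Real.Gamma k / Real.Gamma (k + (1 - q)) := by
  have h1 := Real.Gamma_pos_of_pos (s := (k : ℝ)) (by exact_mod_cast hk)
  have h2 := Real.Gamma_pos_of_pos (s := (k : ℝ) + 1 - q) (by linarith)
  have : 1 - q ≠ 0 := sub_ne_zero.2 hq1.symm
  rw [nnConst, ← Real.rpow_mul (by positivity), one_div_mul_cancel this, Real.rpow_one, add_sub]

/-- The radius at which `n C_k V_m ρ ^ m` takes the value `u`. -/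
noncomputable def nnRadius (m n k : ℕ) (q u : ℝ) : ℝ :=
  (u / (n * nnConst k q * unitBallVol m)) ^ (1 / (m : ℝ))

theorem unitBallVol_mul_nnRadius_pow (hm : 1 ≤ m) (hk : 1 ≤ k) (hq : q < k + 1) {n : ℕ} {u : ℝ}
    (hu : 0 ≤ u) : unitBallVol m * nnRadius m n k q u ^ m = u / (n * nnConst k q) := by
  have hC := nnConst_pos hk hq
  have hV := unitBallVol_pos m
  have hm0 : (m : ℝ) ≠ 0 := by positivity
  rw [nnRadius, ← Real.rpow_natCast, ← Real.rpow_mul (by positivity), one_div_mul_cancel hm0,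
    Real.rpow_one]
  field_simp

theorem nnZeta_nonneg (hk : 1 ≤ k) (hq : q < k + 1) {N i : ℕ} (hN : k + 1 ≤ N)
    (hi : i ∈ Finset.range N) (x : ℕ → EuclideanSpace ℝ (Fin m)) : 0 ≤ nnZeta N k q x i := by
  have h1 : (1 : ℝ) ≤ N := by exact_mod_cast (by omega : 1 ≤ N)
  have h2 : (0 : ℝ) ≤ N - 1 := by linarith
  have := nnConst_pos hk hq
  have := unitBallVol_pos m
  have := kthNNDist_nonneg hk hN hi x
  unfold nnZeta
  positivity

theorem lt_nnZeta_iff (hm : 1 ≤ m) (hk : 1 ≤ k) (hq : q < k + 1) {n i : ℕ} (hn : k ≤ n)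
    (hi : i ∈ Finset.range (n + 1)) (x : ℕ → EuclideanSpace ℝ (Fin m)) {u : ℝ} (hu : 0 ≤ u) :
    u < nnZeta (n + 1) k q x i ↔ nnRadius m n k q u < kthNNDist (n + 1) k x i := by
  have hn0 : (0 : ℝ) < n := by exact_mod_cast (by omega : 0 < n)
  have hD : 0 < n * nnConst k q * unitBallVol m :=
    mul_pos (mul_pos hn0 (nnConst_pos hk hq)) (unitBallVol_pos m)
  have hρ := kthNNDist_nonneg hk (by omega) hi x
  have hm0 : (0 : ℝ) < m := by exact_mod_cast hm
  rw [nnRadius, one_div, Real.rpow_inv_lt_iff_of_pos (by positivity) hρ hm0, div_lt_iff₀ hD,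
    Real.rpow_natCast, nnZeta, mul_comm (_ ^ m)]
  push_cast
  rw [add_sub_cancel_right]

variable {Ω : Type*} [MeasurableSpace Ω] {P : Measure Ω} [IsProbabilityMeasure P]
  {X : ℕ → Ω → EuclideanSpace ℝ (Fin m)} {μ : Measure (EuclideanSpace ℝ (Fin m))}
  {f : EuclideanSpace ℝ (Fin m) → ℝ}

theorem measurable_nnZeta (hk : 1 ≤ k) {N i : ℕ} (hN : k + 1 ≤ N) (hi : i ∈ Finset.range N)
    (hX : ∀ i, Measurable (X i)) : Measurable fun ω => nnZeta N k q (fun i => X i ω) i := by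
  unfold nnZeta
  exact ((measurable_kthNNDist hk hN hi hX).pow_const m).const_mul _

/-- `ℙ (ζ > u)` for a sample of `n + 1` points with law `μ`. -/
noncomputable def nnZetaTail (μ : Measure (EuclideanSpace ℝ (Fin m))) (n k : ℕ) (q u : ℝ) : ℝ≥0∞ :=
  ∫⁻ x, ENNReal.ofReal
    (binomialTail n k (μ.real (Metric.closedBall x (nnRadius m n k q u)))) ∂μ

theorem measure_lt_nnZeta (hm : 1 ≤ m) (hk : 1 ≤ k) (hq : q < k + 1) {n i : ℕ} (hn : k ≤ n)
    (hi : i ∈ Finset.range (n + 1)) (hX : ∀ i, Measurable (X i)) (hindep : iIndepFun X P)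
    (hlaw : ∀ i, P.map (X i) = μ) {u : ℝ} (hu : 0 ≤ u) :
    P {ω | u < nnZeta (n + 1) k q (fun i => X i ω) i} = nnZetaTail μ n k q u := by
  simp only [lt_nnZeta_iff hm hk hq hn hi _ hu]
  exact measure_lt_kthNNDist hk (by omega) hi hX hindep hlaw _

/-- Lebesgue differentiation: the ball has volume `u / (n * nnConst k q)` and its radius tends to
`0`, so the ratio of its `μ`-mass to its volume tends to `f x` almost everywhere. -/
theorem ae_tendsto_mul_measureReal_closedBall (hm : 1 ≤ m) (hk : 1 ≤ k) (hq : q < k + 1)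
    (hf : Measurable f) (hf0 : ∀ x, 0 ≤ f x)
    [IsProbabilityMeasure (volume.withDensity fun x => ENNReal.ofReal (f x))] {u : ℝ}
    (hu : 0 < u) :
    ∀ᵐ x, Tendsto (fun n : ℕ => n * (volume.withDensity fun x => ENNReal.ofReal (f x)).real
      (Metric.closedBall x (nnRadius m n k q u))) atTop (𝓝 (f x / nnConst k q * u)) := by
  set μ := volume.withDensity fun x => ENNReal.ofReal (f x) with hμ
  have hC := nnConst_pos hk hq
  have hV := unitBallVol_pos m
  have hm0 : (0 : ℝ) < m := by exact_mod_cast hm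
  have hR : Tendsto (fun n : ℕ => nnRadius m n k q u) atTop (𝓝[>] 0) := by
    refine tendsto_nhdsWithin_iff.2 ⟨?_, ?_⟩
    · have h1 : Tendsto (fun n : ℕ => u / (n * nnConst k q * unitBallVol m)) atTop (𝓝 0) :=
        tendsto_const_nhds.div_atTop
          ((tendsto_natCast_atTop_atTop.atTop_mul_const hC).atTop_mul_const hV)
      have h2 := h1.rpow_const (p := 1 / (m : ℝ)) (Or.inr (by positivity))
      rwa [Real.zero_rpow (by positivity)] at h2
    · filter_upwards [eventually_ge_atTop 1] with n hn
      have : (0 : ℝ) < n := by exact_mod_cast hn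
      rw [Set.mem_Ioi, nnRadius]
      positivity
  filter_upwards [Besicovitch.ae_tendsto_rnDeriv μ volume,
    Measure.rnDeriv_withDensity volume hf.ennreal_ofReal] with x hx hx'
  rw [hx'] at hx
  have h1 := (ENNReal.tendsto_toReal ENNReal.ofReal_ne_top).comp (hx.comp hR)
  rw [ENNReal.toReal_ofReal (hf0 x)] at h1
  have h2 := h1.mul_const (u / nnConst k q)
  rw [show f x / nnConst k q * u = f x * (u / nnConst k q) by ring]
  refine h2.congr' ?_
  filter_upwards [eventually_ge_atTop 1] with n hn
  have hn0 : (0 : ℝ) < n := by exact_mod_cast hn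
  have hR0 : 0 ≤ nnRadius m n k q u := by rw [nnRadius]; positivity
  simp only [Function.comp_apply]
  rw [ENNReal.toReal_div, volume_closedBall_eq_unitBallVol hm x hR0,
    unitBallVol_mul_nnRadius_pow hm hk hq hu.le, ENNReal.toReal_ofReal (by positivity),
    ← measureReal_def]
  field_simp

/-- Read off from the fact that the binomial sum is a probability; it supplies the dominating
constant in the next limit. -/
theorem ofReal_binomialTail_le_one (hX : ∀ i, Measurable (X i)) (hindep : iIndepFun X P)
    (hlaw : ∀ i, P.map (X i) = μ) {B : Set (EuclideanSpace ℝ (Fin m))} (hB : MeasurableSet B)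
    (n : ℕ) : ENNReal.ofReal (binomialTail n k (μ.real B)) ≤ 1 := by
  have h := measure_card_filter_mem_lt (k := k) hX hindep hlaw hB (Finset.range n)
  rw [Finset.card_range] at h
  exact h ▸ prob_le_one

theorem tendsto_nnZetaTail (hm : 1 ≤ m) (hk : 1 ≤ k) (hq : q < k + 1) (hf : Measurable f)
    (hf0 : ∀ x, 0 ≤ f x) (hX : ∀ i, Measurable (X i)) (hindep : iIndepFun X P)
    (hlaw : ∀ i, P.map (X i) = volume.withDensity fun x => ENNReal.ofReal (f x)) {u : ℝ}
    (hu : 0 < u) :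
    Tendsto (fun n => nnZetaTail (volume.withDensity fun x => ENNReal.ofReal (f x)) n k q u) atTop
      (𝓝 (∫⁻ x, ENNReal.ofReal (poissonTail k (f x / nnConst k q * u))
        ∂(volume.withDensity fun x => ENNReal.ofReal (f x)))) := by
  set μ := volume.withDensity fun x => ENNReal.ofReal (f x) with hμ
  have hμp : IsProbabilityMeasure μ := by
    rw [← hlaw 0]; exact Measure.isProbabilityMeasure_map (hX 0).aemeasurable
  refine tendsto_lintegral_of_dominated_convergence (fun _ => 1) (fun n => ?_)
    (fun n => ae_of_all _ fun x => ofReal_binomialTail_le_one hX hindep hlaw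
      Metric.isClosed_closedBall.measurableSet n) (by simp) ?_
  · have h1 : Measurable fun x => μ.real (Metric.closedBall x (nnRadius m n k q u)) :=
      (measurable_measure_closedBall _).ennreal_toReal
    unfold binomialTail
    fun_prop
  · filter_upwards [(withDensity_absolutelyContinuous _ _).ae_le
      (ae_tendsto_mul_measureReal_closedBall hm hk hq hf hf0 hu)] with x hx
    exact ENNReal.tendsto_ofReal (tendsto_binomialTail k hx)

end Estimator

/-! ### Uniform tail bounds and the value of the limit -/

section Bounds

variable {m k : ℕ} {q : ℝ} {Ω : Type*} [MeasurableSpace Ω] {P : Measure Ω}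
  [IsProbabilityMeasure P] {X : ℕ → Ω → EuclideanSpace ℝ (Fin m)}
  {μ : Measure (EuclideanSpace ℝ (Fin m))} {f : EuclideanSpace ℝ (Fin m) → ℝ}

theorem lintegral_one_add_norm_rpow_ne_top [IsProbabilityMeasure μ] {r : ℝ} (hr : 0 < r)
    (hμ : ∫⁻ x, ENNReal.ofReal (‖x‖ ^ r) ∂μ ≠ ∞) :
    ∫⁻ x, ENNReal.ofReal ((1 + ‖x‖) ^ r) ∂μ ≠ ∞ := by
  have h : ∀ x : EuclideanSpace ℝ (Fin m), ENNReal.ofReal ((1 + ‖x‖) ^ r) ≤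
      ENNReal.ofReal (2 ^ r) * (1 + ENNReal.ofReal (‖x‖ ^ r)) := by
    intro x
    rw [← ENNReal.ofReal_one, ← ENNReal.ofReal_add zero_le_one (by positivity),
      ← ENNReal.ofReal_mul (by positivity)]
    refine ENNReal.ofReal_le_ofReal ?_
    have hx := norm_nonneg x
    rcases le_total ‖x‖ 1 with h1 | h1
    · calc (1 + ‖x‖) ^ r ≤ 2 ^ r := by gcongr; linarith
        _ ≤ 2 ^ r * (1 + ‖x‖ ^ r) :=
          le_mul_of_one_le_right (by positivity) (by linarith [Real.rpow_nonneg hx r])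
    · calc (1 + ‖x‖) ^ r ≤ (2 * ‖x‖) ^ r := by gcongr; linarith
        _ = 2 ^ r * ‖x‖ ^ r := Real.mul_rpow (by norm_num) hx
        _ ≤ 2 ^ r * (1 + ‖x‖ ^ r) := by gcongr; linarith
  refine ne_top_of_le_ne_top ?_ (lintegral_mono h)
  rw [lintegral_const_mul' _ _ ENNReal.ofReal_ne_top, lintegral_add_left measurable_const,
    lintegral_const, measure_univ, one_mul]
  exact ENNReal.mul_ne_top ENNReal.ofReal_ne_top (ENNReal.add_ne_top.2 ⟨ENNReal.one_ne_top, hμ⟩)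

/-- A polynomial tail bound for `ζ`, uniform in the sample size, under a moment condition. -/
theorem exists_nnZetaTail_le (hm : 1 ≤ m) (hk : 1 ≤ k) (hq : q < k + 1)
    (hX : ∀ i, Measurable (X i)) (hindep : iIndepFun X P) (hlaw : ∀ i, P.map (X i) = μ)
    {s r : ℝ} (hs0 : 0 < s) (hs1 : s < 1) (hr : m * s < r * (1 - s))
    (hμ : ∫⁻ x, ENNReal.ofReal ((1 + ‖x‖) ^ r) ∂μ ≠ ∞) :
    ∃ K : ℝ, ∀ n, k ≤ n → ∀ u, 0 < u → nnZetaTail μ n k q u ≤ ENNReal.ofReal (K * u ^ (-s)) := by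
  obtain ⟨K, hK0, hK⟩ := exists_sum_kthNNDist_rpow_le hm hk hs0 hs1 hr
  have hC := nnConst_pos hk hq
  have hV := unitBallVol_pos m
  set L := (nnConst k q * unitBallVol m) ^ s * K with hL
  set Mr := ∫⁻ x, ENNReal.ofReal ((1 + ‖x‖) ^ r) ∂μ with hMr
  refine ⟨L * Mr.toReal, fun n hn u hu => ?_⟩
  have hN : k + 1 ≤ n + 1 := by omega
  have hsum : ∀ x : ℕ → EuclideanSpace ℝ (Fin m),
      ∑ i ∈ Finset.range (n + 1), nnZeta (n + 1) k q x i ^ s ≤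
        L * ∑ i ∈ Finset.range (n + 1), (1 + ‖x i‖) ^ r := by
    intro x
    calc ∑ i ∈ Finset.range (n + 1), nnZeta (n + 1) k q x i ^ s
        = (nnConst k q * unitBallVol m) ^ s * ((n : ℝ) ^ s *
            ∑ i ∈ Finset.range (n + 1), (kthNNDist (n + 1) k x i ^ m) ^ s) := by
          rw [Finset.mul_sum, Finset.mul_sum]
          refine Finset.sum_congr rfl fun i hi => ?_
          have := kthNNDist_nonneg hk hN hi x
          rw [nnZeta, ← Real.mul_rpow (by positivity) (by positivity),
            ← Real.mul_rpow (by positivity) (by positivity)]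
          congr 1
          push_cast
          ring
      _ ≤ (nnConst k q * unitBallVol m) ^ s * (((n + 1 : ℕ) : ℝ) ^ s *
            ∑ i ∈ Finset.range (n + 1), (kthNNDist (n + 1) k x i ^ m) ^ s) := by
          have : 0 ≤ ∑ i ∈ Finset.range (n + 1), (kthNNDist (n + 1) k x i ^ m) ^ s :=
            Finset.sum_nonneg fun i hi => by
              have := kthNNDist_nonneg hk hN hi x
              positivity
          gcongr
          omega
      _ ≤ _ := by
          rw [hL, mul_assoc]
          exact mul_le_mul_of_nonneg_left (hK _ hN x) (by positivity)
  have hζ : ∀ i ∈ Finset.range (n + 1),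
      Measurable fun ω => ENNReal.ofReal (nnZeta (n + 1) k q (fun i => X i ω) i ^ s) :=
    fun i hi => ((measurable_nnZeta hk hN hi hX).pow_const s).ennreal_ofReal
  -- Markov's inequality is applied to each `i` and then summed, because the packing bound controls
  -- only the sum over the sample. The tail does not depend on `i`, so the factor `n + 1` cancels at
  -- the end.
  have hmark : ∀ i ∈ Finset.range (n + 1), ENNReal.ofReal (u ^ s) * nnZetaTail μ n k q u ≤
      ∫⁻ ω, ENNReal.ofReal (nnZeta (n + 1) k q (fun i => X i ω) i ^ s) ∂P := by
    intro i hi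
    rw [← measure_lt_nnZeta hm hk hq hn hi hX hindep hlaw hu.le]
    refine le_trans ?_ (mul_meas_ge_le_lintegral (hζ i hi) (ENNReal.ofReal (u ^ s)))
    gcongr with ω
    intro h
    exact ENNReal.ofReal_le_ofReal (Real.rpow_le_rpow hu.le (le_of_lt h) hs0.le)
  have hmom : ∑ i ∈ Finset.range (n + 1),
      ∫⁻ ω, ENNReal.ofReal (nnZeta (n + 1) k q (fun i => X i ω) i ^ s) ∂P ≤
        ((n + 1 : ℕ) : ℝ≥0∞) * (ENNReal.ofReal L * Mr) := by
    rw [← lintegral_finsetSum _ hζ]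
    calc ∫⁻ ω, ∑ i ∈ Finset.range (n + 1),
          ENNReal.ofReal (nnZeta (n + 1) k q (fun i => X i ω) i ^ s) ∂P
        ≤ ∫⁻ ω, ENNReal.ofReal L * ∑ i ∈ Finset.range (n + 1),
          ENNReal.ofReal ((1 + ‖X i ω‖) ^ r) ∂P := by
          refine lintegral_mono fun ω => ?_
          rw [← ENNReal.ofReal_sum_of_nonneg fun i hi =>
              Real.rpow_nonneg (nnZeta_nonneg hk hq hN hi _) s,
            ← ENNReal.ofReal_sum_of_nonneg fun i _ => by positivity,
            ← ENNReal.ofReal_mul (by positivity)]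
          exact ENNReal.ofReal_le_ofReal (hsum fun i => X i ω)
      _ = ((n + 1 : ℕ) : ℝ≥0∞) * (ENNReal.ofReal L * Mr) := by
          have hm1 : ∀ i, Measurable fun ω => ENNReal.ofReal ((1 + ‖X i ω‖) ^ r) := fun i => by
            have := hX i
            fun_prop
          rw [lintegral_const_mul' _ _ ENNReal.ofReal_ne_top, lintegral_finsetSum _ fun i _ => hm1 i]
          have : ∀ i ∈ Finset.range (n + 1), ∫⁻ ω, ENNReal.ofReal ((1 + ‖X i ω‖) ^ r) ∂P = Mr := by
            intro i _
            rw [hMr, ← hlaw i, lintegral_map (by fun_prop) (hX i)]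
          rw [Finset.sum_congr rfl this, Finset.sum_const, Finset.card_range, nsmul_eq_mul]
          ring
  have hle := (Finset.sum_le_sum hmark).trans hmom
  rw [Finset.sum_const, Finset.card_range, nsmul_eq_mul,
    ENNReal.mul_le_mul_iff_right (by simp) (by simp)] at hle
  have hus : 0 < u ^ s := by positivity
  rw [Real.rpow_neg hu.le, ENNReal.ofReal_mul (by positivity), ENNReal.ofReal_mul (by positivity),
    ENNReal.ofReal_toReal hμ, ENNReal.ofReal_inv_of_pos hus, ← div_eq_mul_inv,
    ENNReal.le_div_iff_mul_le (Or.inl (by simpa using hus)) (Or.inl ENNReal.ofReal_ne_top),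
    mul_comm]
  exact hle

/-- A polynomial bound for the distribution function of `ζ` near zero for bounded densities. -/
theorem measure_nnZeta_le_le (hm : 1 ≤ m) (hk : 1 ≤ k) (hq : q < k + 1)
    (hX : ∀ i, Measurable (X i)) (hindep : iIndepFun X P)
    (hlaw : ∀ i, P.map (X i) = volume.withDensity fun x => ENNReal.ofReal (f x)) {M : ℝ}
    (hM0 : 0 ≤ M) (hM : ∀ᵐ x, f x ≤ M) {n i : ℕ} (hn : k ≤ n)
    (hi : i ∈ Finset.range (n + 1)) {u : ℝ} (hu : 0 ≤ u) :
    P {ω | nnZeta (n + 1) k q (fun i => X i ω) i ≤ u} ≤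
      ENNReal.ofReal ((M * u / nnConst k q) ^ k) := by
  have hC := nnConst_pos hk hq
  have hV := unitBallVol_pos m
  have hn0 : (0 : ℝ) < n := by exact_mod_cast (by omega : 0 < n)
  have hset : {ω | nnZeta (n + 1) k q (fun i => X i ω) i ≤ u} =
      {ω | kthNNDist (n + 1) k (fun i => X i ω) i ≤ nnRadius m n k q u} := by
    ext ω
    simp only [Set.mem_ofPred_eq]
    rw [← not_lt, lt_nnZeta_iff hm hk hq hn hi _ hu, not_lt]
  rw [hset, ENNReal.ofReal_pow (by positivity)]
  refine measure_kthNNDist_le_le hk (by omega) hi hX hindep hlaw fun x => ?_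
  have hR0 : 0 ≤ nnRadius m n k q u := by rw [nnRadius]; positivity
  -- The mass of the ball is at most `M` times its volume `u / (n * nnConst k q)`; the factor `n` of
  -- the union bound then cancels.
  have hball : (volume.withDensity fun x => ENNReal.ofReal (f x))
      (Metric.closedBall x (nnRadius m n k q u)) ≤
      ENNReal.ofReal M * ENNReal.ofReal (u / (n * nnConst k q)) := by
    rw [withDensity_apply _ Metric.isClosed_closedBall.measurableSet,
      ← unitBallVol_mul_nnRadius_pow hm hk hq hu, ← volume_closedBall_eq_unitBallVol hm x hR0,
      ← setLIntegral_const]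
    exact lintegral_mono_ae (ae_restrict_of_ae (hM.mono fun x hx => ENNReal.ofReal_le_ofReal hx))
  refine (mul_le_mul_right hball _).trans (le_of_eq ?_)
  rw [Nat.add_sub_cancel, ← ENNReal.ofReal_natCast, ← ENNReal.ofReal_mul hM0,
    ← ENNReal.ofReal_mul hn0.le]
  congr 1
  field_simp

/-- Integrating a power of the density against the law. -/
theorem lintegral_rpow_withDensity (hf : Measurable f) (hf0 : ∀ x, 0 ≤ f x) (hq0 : q ≠ 0) :
    ∫⁻ x, ENNReal.ofReal (f x ^ (q - 1)) ∂(volume.withDensity fun x => ENNReal.ofReal (f x)) =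
      ∫⁻ x, ENNReal.ofReal (f x ^ q) := by
  rw [lintegral_withDensity_eq_lintegral_mul _ hf.ennreal_ofReal (by fun_prop)]
  refine lintegral_congr fun x => ?_
  rw [Pi.mul_apply, ← ENNReal.ofReal_mul (hf0 x)]
  congr 1
  rcases (hf0 x).eq_or_lt with h | h
  · rw [← h, zero_mul, Real.zero_rpow hq0]
  · rw [Real.rpow_sub_one h.ne']
    field_simp

theorem ae_withDensity_pos (hf : Measurable f) :
    ∀ᵐ x ∂(volume.withDensity fun x => ENNReal.ofReal (f x)), 0 < f x := by
  rw [ae_withDensity_iff hf.ennreal_ofReal]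
  exact ae_of_all _ fun x hx => by simpa using hx

/-- The normalisation by `C_k` makes the limiting moment equal to the power integral. -/
theorem lintegral_limit_eq (hk : 1 ≤ k) (hq0 : q ≠ 0) (hq : q < k + 1) (hq1 : q ≠ 1)
    (hf : Measurable f) (hf0 : ∀ x, 0 ≤ f x)
    [IsProbabilityMeasure (volume.withDensity fun x => ENNReal.ofReal (f x))]
    {F : ℝ → ℝ} (hF : Measurable F)
    (hFint : ∀ c : ℝ, 0 < c → ∫⁻ t in Set.Ioi 0, ENNReal.ofReal (F (c * t ^ (1 / (1 - q)))) =
      ENNReal.ofReal (c ^ (-(1 - q)) * (Real.Gamma (k + (1 - q)) / Real.Gamma k))) :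
    ∫⁻ t in Set.Ioi 0, ∫⁻ x, ENNReal.ofReal (F (f x / nnConst k q * t ^ (1 / (1 - q))))
        ∂(volume.withDensity fun x => ENNReal.ofReal (f x)) =
      ∫⁻ x, ENNReal.ofReal (f x ^ q) := by
  have hC := nnConst_pos hk hq
  have hΓ := Real.Gamma_pos_of_pos (s := (k : ℝ)) (by exact_mod_cast hk)
  have hΓ' := Real.Gamma_pos_of_pos (s := (k : ℝ) + (1 - q)) (by linarith)
  rw [lintegral_lintegral_swap (by unfold Function.uncurry; fun_prop),
    ← lintegral_rpow_withDensity hf hf0 hq0]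
  refine lintegral_congr_ae ?_
  -- The set where `f` vanishes is null for the law, so `c = f x / nnConst k q` may be taken
  -- positive.
  filter_upwards [ae_withDensity_pos hf] with x hx
  rw [hFint _ (by positivity), Real.div_rpow hx.le hC.le, Real.rpow_neg hC.le,
    nnConst_rpow hk hq hq1, neg_sub]
  congr 1
  field_simp

end Bounds

/-! ### Assembling the two cases -/

section Conclusion

variable {m k : ℕ} {q : ℝ} {Ω : Type*} [MeasurableSpace Ω] {P : Measure Ω}
  [IsProbabilityMeasure P] {X : ℕ → Ω → EuclideanSpace ℝ (Fin m)}
  {f : EuclideanSpace ℝ (Fin m) → ℝ}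

omit [IsProbabilityMeasure P] in
/-- Convergence of the expected estimator from convergence of the common moment of the `ζ i`. -/
theorem estimator_tendsto_of_lintegral (hk : 1 ≤ k) (hq : q < k + 1)
    (hX : ∀ i, Measurable (X i)) (hf : Measurable f) (hf0 : ∀ x, 0 ≤ f x) {I : ℕ → ℝ≥0∞}
    (hI : ∀ n, k ≤ n → ∀ i ∈ Finset.range (n + 1),
      ∫⁻ ω, ENNReal.ofReal (nnZeta (n + 1) k q (fun i => X i ω) i ^ (1 - q)) ∂P = I n)
    (hItop : ∀ n, k ≤ n → I n ≠ ∞) (hfI : ∫⁻ x, ENNReal.ofReal (f x ^ q) ≠ ∞)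
    (hlim : Tendsto I atTop (𝓝 (∫⁻ x, ENNReal.ofReal (f x ^ q)))) :
    Integrable (fun x => f x ^ q) ∧
      (∀ N : ℕ, k + 1 ≤ N → Integrable (fun ω => nnEstimator N k q (fun i => X i ω)) P) ∧
      Tendsto (fun N : ℕ => ∫ ω, nnEstimator N k q (fun i => X i ω) ∂P) atTop
        (𝓝 (renyiIntegral f q)) := by
  have hfq0 : ∀ x, 0 ≤ f x ^ q := fun x => Real.rpow_nonneg (hf0 x) q
  have hY0 : ∀ n, k ≤ n → ∀ i ∈ Finset.range (n + 1), ∀ ω,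
      0 ≤ nnZeta (n + 1) k q (fun i => X i ω) i ^ (1 - q) := fun n hn i hi ω =>
    Real.rpow_nonneg (nnZeta_nonneg hk hq (by omega) hi _) _
  have hYm : ∀ n, k ≤ n → ∀ i ∈ Finset.range (n + 1),
      Measurable fun ω => nnZeta (n + 1) k q (fun i => X i ω) i ^ (1 - q) := fun n hn i hi =>
    (measurable_nnZeta hk (by omega) hi hX).pow_const _
  have hYint : ∀ n, k ≤ n → ∀ i ∈ Finset.range (n + 1),
      Integrable (fun ω => nnZeta (n + 1) k q (fun i => X i ω) i ^ (1 - q)) P := fun n hn i hi =>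
    (lintegral_ofReal_ne_top_iff_integrable (hYm n hn i hi).aestronglyMeasurable
      (ae_of_all _ (hY0 n hn i hi))).1 (hI n hn i hi ▸ hItop n hn)
  refine ⟨(lintegral_ofReal_ne_top_iff_integrable (hf.pow_const q).aestronglyMeasurable (ae_of_all _ hfq0)).1 hfI,
    fun N hN => ?_, ?_⟩
  · obtain ⟨n, rfl⟩ : ∃ n, N = n + 1 := ⟨N - 1, by omega⟩
    exact (integrable_finsetSum _ fun i hi => hYint n (by omega) i hi).const_mul _
  · rw [← tendsto_add_atTop_iff_nat 1, renyiIntegral,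
      integral_eq_lintegral_of_nonneg_ae (ae_of_all _ hfq0)
        (hf.pow_const q).aestronglyMeasurable]
    refine ((ENNReal.tendsto_toReal hfI).comp hlim).congr' ?_
    filter_upwards [eventually_ge_atTop k] with n hn
    have hY : ∀ i ∈ Finset.range (n + 1),
        ∫ ω, nnZeta (n + 1) k q (fun i => X i ω) i ^ (1 - q) ∂P = (I n).toReal := fun i hi => by
      rw [integral_eq_lintegral_of_nonneg_ae (ae_of_all _ (hY0 n hn i hi))
        (hYm n hn i hi).aestronglyMeasurable, hI n hn i hi]
    unfold nnEstimator
    rw [integral_const_mul, integral_finsetSum _ fun i hi => hYint n hn i hi,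
      Finset.sum_congr rfl hY, Finset.sum_const, Finset.card_range, nsmul_eq_mul,
      Function.comp_apply]
    field_simp

theorem exists_moment_of_lt_criticalMoment {c : ℝ} (hc : 0 ≤ c)
    (h : ENNReal.ofReal c < criticalMoment f) :
    ∃ r, c < r ∧ ∫⁻ x, ENNReal.ofReal (‖x‖ ^ r * f x) < ∞ := by
  obtain ⟨_, ⟨r, ⟨_, hr⟩, rfl⟩, hlt⟩ := lt_sSup_iff.1 h
  exact ⟨r, (ENNReal.ofReal_lt_ofReal_iff_of_nonneg hc).1 hlt, hr⟩

theorem estimator_tendsto_of_lt_one (hm : 1 ≤ m) (hk : 1 ≤ k) (hq0 : 0 < q) (hq1 : q < 1)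
    (hX : ∀ i, Measurable (X i)) (hindep : iIndepFun X P) (hf : Measurable f) (hf0 : ∀ x, 0 ≤ f x)
    (hlaw : ∀ i, P.map (X i) = volume.withDensity fun x => ENNReal.ofReal (f x))
    (hcrit : ENNReal.ofReal (m * (1 - q) / q) < criticalMoment f) :
    (∀ N : ℕ, k + 1 ≤ N → Integrable (fun ω => nnEstimator N k q (fun i => X i ω)) P) ∧
      Tendsto (fun N : ℕ => ∫ ω, nnEstimator N k q (fun i => X i ω) ∂P) atTop
        (𝓝 (renyiIntegral f q)) := by
  set μ := volume.withDensity fun x => ENNReal.ofReal (f x) with hμ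
  have hμp : IsProbabilityMeasure μ := by
    rw [← hlaw 0]; exact Measure.isProbabilityMeasure_map (hX 0).aemeasurable
  have hq : q < k + 1 := by
    have : (0 : ℝ) ≤ k := Nat.cast_nonneg k
    linarith
  set a := 1 - q with ha
  have ha0 : 0 < a := by linarith
  have hmR : (0 : ℝ) < m := by exact_mod_cast hm
  obtain ⟨r, hr, hrint⟩ := exists_moment_of_lt_criticalMoment (by positivity) hcrit
  rw [div_lt_iff₀ hq0] at hr
  have hr0 : 0 < r := by
    by_contra! h
    nlinarith [mul_pos hmR ha0]
  -- The lower bound on `s` yields the decay exponent `s / a > 1`; the upper bound is the condition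
  -- `m * s < r * (1 - s)` of the packing estimate. The interval is nonempty exactly because `r > m
  -- * (1 - q) / q`.
  obtain ⟨s, has, hsr⟩ : ∃ s, a < s ∧ s < r / (m + r) := by
    refine exists_between ((lt_div_iff₀ (by positivity)).2 ?_)
    rw [show q = 1 - a by rw [ha]; ring] at hr
    linarith
  rw [lt_div_iff₀ (by positivity)] at hsr
  have hs0 : 0 < s := ha0.trans has
  have hs1 : s < 1 := by
    by_contra! h
    nlinarith
  have hmom : ∫⁻ x, ENNReal.ofReal (‖x‖ ^ r) ∂μ ≠ ∞ := by
    rw [hμ, lintegral_withDensity_eq_lintegral_mul _ hf.ennreal_ofReal (by fun_prop)]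
    refine ne_of_lt (lt_of_le_of_lt (le_of_eq (lintegral_congr fun x => ?_)) hrint)
    rw [Pi.mul_apply, mul_comm, ← ENNReal.ofReal_mul (by positivity)]
  obtain ⟨K, hK⟩ := exists_nnZetaTail_le hm hk hq hX hindep hlaw hs0 hs1 (by linarith)
    (lintegral_one_add_norm_rpow_ne_top hr0 hmom)
  have hevent : ∀ n, k ≤ n → ∀ i ∈ Finset.range (n + 1), ∀ t, 0 < t →
      P {ω | t < nnZeta (n + 1) k q (fun i => X i ω) i ^ a} =
        nnZetaTail μ n k q (t ^ (1 / a)) := by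
    intro n hn i hi t ht
    rw [← measure_lt_nnZeta hm hk hq hn hi hX hindep hlaw (by positivity)]
    congr 1
    ext ω
    simp only [Set.mem_ofPred_eq]
    rw [one_div, Real.rpow_inv_lt_iff_of_pos ht.le (nnZeta_nonneg hk hq (by omega) hi _) ha0]
  -- The index `0` stands for all of them: by `hevent` the tail is the same for every `i`.
  set T : ℕ → ℝ → ℝ≥0∞ := fun n t => P {ω | t < nnZeta (n + 1) k q (fun i => X i ω) 0 ^ a} with hT
  have hTe : ∀ n, k ≤ n → ∀ t, 0 < t → T n t = nnZetaTail μ n k q (t ^ (1 / a)) :=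
    fun n hn => hevent n hn 0 (by simp)
  obtain ⟨h1, h2, h3⟩ := tendsto_lintegral_tail (T := T) (n₀ := k) (K := K) (γ := s / a)
    (T' := fun t => ∫⁻ x, ENNReal.ofReal (poissonTail k (f x / nnConst k q * t ^ (1 / a))) ∂μ)
    ((one_lt_div ha0).2 has) (fun n _ t t' htt => measure_mono fun ω hω => lt_of_le_of_lt htt hω)
    (fun n _ t _ => prob_le_one)
    (fun n hn t ht => by
      rw [hTe n hn t ht]
      refine (hK n hn _ (by positivity)).trans (le_of_eq ?_)
      rw [← Real.rpow_mul ht.le]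
      congr 3
      ring)
    (fun t ht => (tendsto_nnZetaTail hm hk hq hf hf0 hX hindep hlaw (by positivity)).congr'
      ((eventually_ge_atTop k).mono fun n hn => (hTe n hn t ht).symm))
  rw [lintegral_limit_eq hk hq0.ne' hq hq1.ne hf hf0 (continuous_poissonTail k).measurable
    fun c hc => lintegral_poissonTail hk ha0 hc] at h2 h3
  refine (estimator_tendsto_of_lintegral hk hq hX hf hf0 (fun n hn i hi => ?_) h1 h2 h3).2
  rw [lintegral_eq_lintegral_meas_lt P (ae_of_all _ fun ω =>
    Real.rpow_nonneg (nnZeta_nonneg hk hq (by omega) hi _) _)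
    ((measurable_nnZeta hk (by omega) hi hX).pow_const _).aemeasurable]
  refine setLIntegral_congr_fun measurableSet_Ioi fun t ht => ?_
  rw [hTe n hn t ht, ← hevent n hn i hi t ht]

theorem estimator_tendsto_of_one_lt (hm : 1 ≤ m) (hk : 1 ≤ k) (hq1 : 1 < q) (hq : q < k + 1)
    (hX : ∀ i, Measurable (X i)) (hindep : iIndepFun X P) (hf : Measurable f) (hf0 : ∀ x, 0 ≤ f x)
    (hlaw : ∀ i, P.map (X i) = volume.withDensity fun x => ENNReal.ofReal (f x)) {M : ℝ}
    (hM0 : 0 ≤ M) (hM : ∀ᵐ x, f x ≤ M) :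
    Integrable (fun x => f x ^ q) ∧
      (∀ N : ℕ, k + 1 ≤ N → Integrable (fun ω => nnEstimator N k q (fun i => X i ω)) P) ∧
      Tendsto (fun N : ℕ => ∫ ω, nnEstimator N k q (fun i => X i ω) ∂P) atTop
        (𝓝 (renyiIntegral f q)) := by
  set μ := volume.withDensity fun x => ENNReal.ofReal (f x) with hμ
  have hμp : IsProbabilityMeasure μ := by
    rw [← hlaw 0]; exact Measure.isProbabilityMeasure_map (hX 0).aemeasurable
  set a := 1 - q with ha
  have ha0 : a < 0 := by linarith
  have hka : 0 < k + a := by linarith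
  have hC := nnConst_pos hk hq
  have hbound : ∀ n, k ≤ n → ∀ i ∈ Finset.range (n + 1), ∀ u, 0 ≤ u →
      P {ω | nnZeta (n + 1) k q (fun i => X i ω) i ≤ u} ≤
        ENNReal.ofReal ((M * u / nnConst k q) ^ k) := fun n hn i hi u hu =>
    measure_nnZeta_le_le hm hk hq hX hindep hlaw hM0 hM hn hi hu
  -- A zero value of `ζ` must be excluded: the real power gives `0 ^ a = 0` for `a < 0`, which would
  -- break the inversion of `t ≤ ζ ^ a`. The bound at `u = 0` vanishes because `k ≥ 1`.
  have hpos : ∀ n, k ≤ n → ∀ i ∈ Finset.range (n + 1),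
      ∀ᵐ ω ∂P, 0 < nnZeta (n + 1) k q (fun i => X i ω) i := by
    intro n hn i hi
    have h := hbound n hn i hi 0 le_rfl
    rw [mul_zero, zero_div, zero_pow (by omega), ENNReal.ofReal_zero] at h
    rw [ae_iff]
    simpa using h
  have hle : ∀ n, k ≤ n → ∀ i ∈ Finset.range (n + 1), ∀ t, 0 < t →
      P {ω | t ≤ nnZeta (n + 1) k q (fun i => X i ω) i ^ a} =
        P {ω | nnZeta (n + 1) k q (fun i => X i ω) i ≤ t ^ (1 / a)} := by
    intro n hn i hi t ht
    refine measure_congr ?_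
    filter_upwards [hpos n hn i hi] with ω hω
    refine propext ?_
    change t ≤ nnZeta (n + 1) k q (fun i => X i ω) i ^ a ↔
      nnZeta (n + 1) k q (fun i => X i ω) i ≤ t ^ (1 / a)
    rw [one_div, Real.le_rpow_inv_iff_of_neg hω ht ha0]
  have hevent : ∀ n, k ≤ n → ∀ i ∈ Finset.range (n + 1), ∀ t, 0 < t →
      P {ω | t ≤ nnZeta (n + 1) k q (fun i => X i ω) i ^ a} =
        1 - nnZetaTail μ n k q (t ^ (1 / a)) := by
    intro n hn i hi t ht
    rw [hle n hn i hi t ht,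
      ← measure_lt_nnZeta hm hk hq hn hi hX hindep hlaw (by positivity : 0 ≤ t ^ (1 / a)),
      ← prob_compl_eq_one_sub
        (measurableSet_lt measurable_const (measurable_nnZeta hk (by omega) hi hX))]
    congr 1
    ext ω
    simp
  set T : ℕ → ℝ → ℝ≥0∞ := fun n t => P {ω | t ≤ nnZeta (n + 1) k q (fun i => X i ω) 0 ^ a} with hT
  have hTe : ∀ n, k ≤ n → ∀ t, 0 < t → T n t = 1 - nnZetaTail μ n k q (t ^ (1 / a)) :=
    fun n hn => hevent n hn 0 (by simp)
  have hQm : ∀ t : ℝ, Measurable fun x => poissonTail k (f x / nnConst k q * t ^ (1 / a)) :=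
    fun t => (continuous_poissonTail k).measurable.comp (by fun_prop)
  have hlimeq : ∀ t, 0 < t →
      1 - ∫⁻ x, ENNReal.ofReal (poissonTail k (f x / nnConst k q * t ^ (1 / a))) ∂μ =
        ∫⁻ x, ENNReal.ofReal (1 - poissonTail k (f x / nnConst k q * t ^ (1 / a))) ∂μ := by
    intro t ht
    have hle1 : ∀ x, ENNReal.ofReal (poissonTail k (f x / nnConst k q * t ^ (1 / a))) ≤ 1 := by
      intro x
      have := hf0 x
      exact ENNReal.ofReal_le_one.2 (poissonTail_le_one k (by positivity))
    have hne : ∫⁻ x, ENNReal.ofReal (poissonTail k (f x / nnConst k q * t ^ (1 / a))) ∂μ ≠ ∞ :=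
      ne_top_of_le_ne_top (by simp) (lintegral_mono hle1)
    have h := lintegral_sub (μ := μ) (f := fun _ => 1) (hQm t).ennreal_ofReal hne (ae_of_all _ hle1)
    rw [lintegral_one, measure_univ] at h
    rw [← h]
    refine lintegral_congr fun x => ?_
    have := hf0 x
    rw [ENNReal.ofReal_sub _ (poissonTail_nonneg k (by positivity)), ENNReal.ofReal_one]
  -- At `u = t ^ (1 / a)` the bound `(M * u / C_k) ^ k` decays with exponent `k / (q - 1)`, which
  -- exceeds `1` exactly when `q < k + 1`.
  obtain ⟨h1, h2, h3⟩ := tendsto_lintegral_tail (T := T) (n₀ := k)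
    (K := (M / nnConst k q) ^ k) (γ := k / (-a))
    (T' := fun t => ∫⁻ x, ENNReal.ofReal (1 - poissonTail k (f x / nnConst k q * t ^ (1 / a))) ∂μ)
    ((one_lt_div (by linarith)).2 (by linarith))
    (fun n _ t t' htt => measure_mono fun ω hω => le_trans htt hω)
    (fun n _ t _ => prob_le_one)
    (fun n hn t ht => by
      simp only [hT]
      rw [hle n hn 0 (by simp) t ht]
      refine (hbound n hn 0 (by simp) _ (by positivity)).trans (le_of_eq ?_)
      rw [show M * t ^ (1 / a) / nnConst k q = M / nnConst k q * t ^ (1 / a) by ring, mul_pow,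
        ← Real.rpow_mul_natCast ht.le]
      congr 3
      have := ha0.ne
      field_simp)
    (fun t ht => by
      rw [← hlimeq t ht]
      refine (ENNReal.Tendsto.sub tendsto_const_nhds (tendsto_nnZetaTail hm hk hq hf hf0 hX hindep
        hlaw (by positivity)) (Or.inl ENNReal.one_ne_top)).congr'
        ((eventually_ge_atTop k).mono fun n hn => (hTe n hn t ht).symm))
  rw [lintegral_limit_eq hk (by linarith) hq hq1.ne' hf hf0
    (F := fun y => 1 - poissonTail k y) (measurable_const.sub (continuous_poissonTail k).measurable)
    fun c hc => lintegral_one_sub_poissonTail hk ha0 hka hc] at h2 h3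
  refine estimator_tendsto_of_lintegral hk hq hX hf hf0 (fun n hn i hi => ?_) h1 h2 h3
  rw [lintegral_eq_lintegral_meas_le P (ae_of_all _ fun ω =>
    Real.rpow_nonneg (nnZeta_nonneg hk hq (by omega) hi _) _)
    ((measurable_nnZeta hk (by omega) hi hX).pow_const _).aemeasurable]
  refine setLIntegral_congr_fun measurableSet_Ioi fun t ht => ?_
  rw [hTe n hn t ht, ← hevent n hn i hi t ht]

end Conclusion

theorem theorem3p1 {Ω : Type*} [MeasurableSpace Ω] (P : Measure Ω) [IsProbabilityMeasure P]
    (m : ℕ) (hm : 1 ≤ m) (k : ℕ) (hk : 1 ≤ k)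
    (f : EuclideanSpace ℝ (Fin m) → ℝ) (hf : Measurable f) (hf0 : ∀ x, 0 ≤ f x)
    (X : ℕ → Ω → EuclideanSpace ℝ (Fin m)) (hX : ∀ i, Measurable (X i))
    (hindep : iIndepFun X P)
    (hlaw : ∀ i, P.map (X i) = volume.withDensity (fun x => ENNReal.ofReal (f x))) :
    (∀ q : ℝ, 0 < q → q < 1 → Integrable (fun x => f x ^ q) →
      ENNReal.ofReal (m * (1 - q) / q) < criticalMoment f →
        (∀ N : ℕ, k + 1 ≤ N → Integrable (fun ω => nnEstimator N k q (fun i => X i ω)) P) ∧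
        Tendsto (fun N : ℕ => ∫ ω, nnEstimator N k q (fun i => X i ω) ∂P) atTop
          (𝓝 (renyiIntegral f q))) ∧
    (∀ q : ℝ, 1 < q → q < k + 1 → (∃ M : ℝ, ∀ᵐ x, f x ≤ M) →
        Integrable (fun x => f x ^ q) ∧
        (∀ N : ℕ, k + 1 ≤ N → Integrable (fun ω => nnEstimator N k q (fun i => X i ω)) P) ∧
        Tendsto (fun N : ℕ => ∫ ω, nnEstimator N k q (fun i => X i ω) ∂P) atTop
          (𝓝 (renyiIntegral f q))) := by
  -- The essential bound `M` is replaced by `max M 0` to make it nonnegative.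
  refine ⟨fun q hq0 hq1 _ hcrit =>
    estimator_tendsto_of_lt_one hm hk hq0 hq1 hX hindep hf hf0 hlaw hcrit, fun q hq1 hq ⟨M, hM⟩ =>
    estimator_tendsto_of_one_lt hm hk hq1 hq hX hindep hf hf0 hlaw (le_max_right M 0) ?_⟩
  exact hM.mono fun x hx => hx.trans (le_max_left M 0)
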